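/- Let $k$ be a field, let $n\ge 2$, and let $\mathcal A=\{d_1,\dots,d_n\}$ be a set of $n$ distinct positive integers. Let $I_{\mathcal A}\subset k[x_1,\dots,x_n]$ be the toric ideal of $\mathcal A$, i.e. the kernel of the $k$-algebra homomorphism $k[x_1,\dots,x_n]\to k[t]$, $x_i\mapsto t^{d_i}$. It is called a complete intersection if its minimal number of generators equals its height. For $1\le i\le n$ put $$m_i:=\min\Big\{b\in\mathbb Z^+ \;\Big|\; b\,d_i\in\sum_{j\ne i}\mathbb N\,d_j\Big\}.$$ The reduction $\mathcal A_{red}$ is defined as follows. To a finite family $\mathcal B=\{b_1,\dots,b_r\}$ of natural numbers one may apply the following steps: 1. remove $b_i$ if $b_i\notin\sum_{j\ne i}\mathbb Q\,b_j$; 2. remove $b_i$ if $b_i\in\sum_{j\ne i}\mathbb N\,b_j$; 3. if $b_i\in\sum_{j\ne i}\mathbb Q\,b_j$, replace $b_i$ by $B_ib_i$, where $B_i:=\min\{B\in\mathbb Z^+\mid B\,b_i\in\sum_{j\ne i}\mathbb Z\,b_j\}$. Starting from $\mathcal A$ and iterating these steps one reaches a unique family $\mathcal A_{red}=\{b_1',\dots,b_r'\}$,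 possibly empty, such that $b_i'\in\sum_{j\ne i}\mathbb Z\,b_j'\setminus\sum_{j\ne i}\mathbb N\,b_j'$ for all $i\in\{1,\dots,r\}$. Suppose that $n-1$ of the integers $m_1d_1,\dots,m_nd_n$ are pairwise different, i.e. there is an index $i_0$ such that the numbers $m_id_i$ with $i\ne i_0$ are pairwise distinct. Then $$I_{\mathcal A}\text{ is a complete intersection}\iff \mathcal A_{red}=\emptyset .$$ -/

import Mathlib

/-! ### Toric ideals of affine monomial curves and complete intersections -/

/-- The toric ideal of the family `d`: the kernel of the `k`-algebra homomorphism
`k[x₁, …, xₙ] → k[t]`, `xᵢ ↦ t ^ dᵢ`. -/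
noncomputable def toricIdeal (k : Type*) [Field k] {n : ℕ} (d : Fin n → ℕ) :
    Ideal (MvPolynomial (Fin n) k) :=
  RingHom.ker (MvPolynomial.aeval (R := k) (fun i => (Polynomial.X : Polynomial k) ^ d i))

/-- `I` is a complete intersection: it is finitely generated, and its minimal number of
generators equals its height. -/
def IsCompleteIntersection {R : Type*} [CommRing R] (I : Ideal R) : Prop :=
  I.FG ∧ (Submodule.spanFinrank I : ℕ∞) = I.height

/-- `mᵢ`: the least positive `b` such that `b * dᵢ` lies in the semigroup `∑_{j ≠ i} ℕ dⱼ`. -/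
noncomputable def critMult {n : ℕ} (d : Fin n → ℕ) (i : Fin n) : ℕ :=
  sInf {b : ℕ | 0 < b ∧ b * d i ∈ AddSubmonoid.closure (d '' {j | j ≠ i})}

/-! ### The reduced set

Sets of natural numbers `{b₁, …, bₙ}` are handled as multisets, since scaling one element may
make it equal to another one; the fully reduced multisets have no repeated elements. -/

namespace CIReduction

/-- The semigroup `∑ ℕ x` over the elements `x` of `t`. -/
def natSpan (t : Multiset ℕ) : AddSubmonoid ℕ := AddSubmonoid.closure {x | x ∈ t}

/-- The group `∑ ℤ x` over the elements `x` of `t`. -/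
def intSpan (t : Multiset ℕ) : AddSubgroup ℤ :=
  AddSubgroup.closure ((fun x : ℕ => (x : ℤ)) '' {x | x ∈ t})

/-- The vector space `∑ ℚ x` over the elements `x` of `t`. -/
def ratSpan (t : Multiset ℕ) : Submodule ℚ ℚ :=
  Submodule.span ℚ ((fun x : ℕ => (x : ℚ)) '' {x | x ∈ t})

/-- The least positive `B` with `B * b` in the group generated by `t`. -/
noncomputable def index (b : ℕ) (t : Multiset ℕ) : ℕ :=
  sInf {B : ℕ | 0 < B ∧ ((B * b : ℕ) : ℤ) ∈ intSpan t}

/-- One reduction step, applied to the element `b` of `b ::ₘ t`. -/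
inductive Step : Multiset ℕ → Multiset ℕ → Prop
  | removeIndep (b : ℕ) (t : Multiset ℕ) : (b : ℚ) ∉ ratSpan t → Step (b ::ₘ t) t
  | removeMem (b : ℕ) (t : Multiset ℕ) : b ∈ natSpan t → Step (b ::ₘ t) t
  | scale (b : ℕ) (t : Multiset ℕ) : (b : ℚ) ∈ ratSpan t → index b t ≠ 1 →
      Step (b ::ₘ t) ((index b t * b) ::ₘ t)

/-- Every element lies in the group, but not in the semigroup, generated by the others. -/
def IsReduced (s : Multiset ℕ) : Prop :=
  ∀ b ∈ s, (b : ℤ) ∈ intSpan (s.erase b) ∧ b ∉ natSpan (s.erase b)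

/-- `r` is obtained from `s` by iterated reduction steps, and is reduced. -/
def IsReductionOf (s r : Multiset ℕ) : Prop :=
  Relation.ReflTransGen Step s r ∧ IsReduced r

theorem mem_intSpan (t : Multiset ℕ) (z : ℤ) : z ∈ intSpan t ↔ (t.gcd : ℤ) ∣ z := by
  have key : intSpan t = AddSubgroup.zmultiples (t.gcd : ℤ) := by
    induction t using Multiset.induction with
    | empty => simp [intSpan]
    | cons a t ih =>
      have h1 : {x | x ∈ a ::ₘ t} = insert a {x | x ∈ t} := by ext; simp
      have h2 : intSpan (a ::ₘ t) = AddSubgroup.zmultiples (a : ℤ) ⊔ intSpan t := by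
        simp only [intSpan]
        rw [h1, Set.image_insert_eq, Set.insert_eq, AddSubgroup.closure_union,
          AddSubgroup.zmultiples_eq_closure]
      rw [h2, ih, Int.zmultiples_sup, Multiset.gcd_cons]
      rfl
  rw [key, Int.mem_zmultiples_iff]

theorem mem_ratSpan (t : Multiset ℕ) (b : ℕ) :
    (b : ℚ) ∈ ratSpan t ↔ b = 0 ∨ t.gcd ≠ 0 := by
  constructor
  · intro h
    by_contra! hc
    have h0 := (Multiset.gcd_eq_zero_iff t).1 hc.2
    have hle : ratSpan t ≤ ⊥ := by
      refine Submodule.span_le.2 ?_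
      rintro _ ⟨x, hx, rfl⟩
      simp [h0 x hx]
    have := hle h
    simp at this
    exact hc.1 this
  · rintro (rfl | h)
    · simp
    · obtain ⟨x, hx, hx0⟩ := (Multiset.gcd_ne_zero_iff t).1 h
      have hm : (x : ℚ) ∈ ratSpan t := Submodule.subset_span ⟨x, hx, rfl⟩
      have := (ratSpan t).smul_mem ((b : ℚ) / x) hm
      have hxq : (x : ℚ) ≠ 0 := by exact_mod_cast hx0
      simpa [hxq] using this

theorem mem_natSpan_cons (c : ℕ) (w : Multiset ℕ) (x : ℕ) :
    x ∈ natSpan (c ::ₘ w) ↔ ∃ a, ∃ y ∈ natSpan w, x = a * c + y := by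
  have h1 : {x | x ∈ c ::ₘ w} = insert c {x | x ∈ w} := by ext; simp
  simp only [natSpan, h1]
  rw [Set.insert_eq, AddSubmonoid.closure_union, AddSubmonoid.mem_sup]
  simp only [AddSubmonoid.mem_closure_singleton]
  constructor
  · rintro ⟨_, ⟨a, rfl⟩, y, hy, rfl⟩
    exact ⟨a, y, hy, by simp⟩
  · rintro ⟨a, y, hy, rfl⟩
    exact ⟨_, ⟨a, rfl⟩, y, hy, by simp⟩

theorem gcd_dvd_of_mem_natSpan {t : Multiset ℕ} {x : ℕ} (h : x ∈ natSpan t) : t.gcd ∣ x := by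
  refine AddSubmonoid.closure_induction (motive := fun x _ => t.gcd ∣ x) ?_ ?_ ?_ h
  · intro x hx
    exact Multiset.gcd_dvd hx
  · simp
  · intro x y _ _ hx hy
    exact dvd_add hx hy

theorem index_eq_of {b : ℕ} {t : Multiset ℕ} {B : ℕ} (hB : 0 < B)
    (h : ∀ x : ℕ, t.gcd ∣ x * b ↔ B ∣ x) : index b t = B := by
  have hs : {B : ℕ | 0 < B ∧ ((B * b : ℕ) : ℤ) ∈ intSpan t} = {x | 0 < x ∧ B ∣ x} := by
    ext x
    simp only [Set.mem_ofPred_eq, mem_intSpan, Int.natCast_dvd_natCast, h]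
  rw [index, hs]
  refine le_antisymm (Nat.sInf_le ⟨hB, dvd_rfl⟩) ?_
  have := Nat.sInf_mem (s := {x | 0 < x ∧ B ∣ x}) ⟨B, hB, dvd_rfl⟩
  exact Nat.le_of_dvd this.1 this.2

theorem index_spec {b : ℕ} {t : Multiset ℕ} (hb : (b : ℚ) ∈ ratSpan t) :
    0 < index b t ∧ ∀ x : ℕ, t.gcd ∣ x * b ↔ index b t ∣ x := by
  rw [mem_ratSpan] at hb
  have : ∃ B, 0 < B ∧ ∀ x : ℕ, t.gcd ∣ x * b ↔ B ∣ x := by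
    rcases Nat.eq_zero_or_pos b with rfl | hb0
    · exact ⟨1, by simp⟩
    · have hG : 0 < t.gcd := Nat.pos_of_ne_zero (hb.resolve_left hb0.ne')
      have hg : 0 < Nat.gcd t.gcd b := Nat.gcd_pos_of_pos_left _ hG
      obtain ⟨B, hB⟩ := Nat.gcd_dvd_left t.gcd b
      obtain ⟨b', hb'⟩ := Nat.gcd_dvd_right t.gcd b
      have hco : Nat.Coprime B b' := by
        have := Nat.coprime_div_gcd_div_gcd hg
        rwa [Nat.div_eq_of_eq_mul_right hg hB, Nat.div_eq_of_eq_mul_right hg hb'] at this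
      refine ⟨B, Nat.pos_of_ne_zero ?_, fun x => ?_⟩
      · rintro rfl
        rw [mul_zero] at hB
        omega
      · have e : t.gcd ∣ x * b ↔
            Nat.gcd t.gcd b * B ∣ Nat.gcd t.gcd b * (x * b') := by
          rw [← hB]
          conv_lhs => rw [hb']
          rw [show x * (Nat.gcd t.gcd b * b') = Nat.gcd t.gcd b * (x * b') by ring]
        rw [e, Nat.mul_dvd_mul_iff_left hg]
        exact ⟨fun h => hco.dvd_of_dvd_mul_right h, fun h => h.mul_right _⟩
  obtain ⟨B, hB, h⟩ := this
  rw [index_eq_of hB h]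
  exact ⟨hB, h⟩

theorem index_spec_int {b : ℕ} {t : Multiset ℕ} (hb : (b : ℚ) ∈ ratSpan t) (x : ℤ) :
    (t.gcd : ℤ) ∣ x * b ↔ (index b t : ℤ) ∣ x := by
  rw [Int.natCast_dvd, Int.natCast_dvd, Int.natAbs_mul, Int.natAbs_natCast]
  exact (index_spec hb).2 _

theorem exists_step_of_not_isReduced {s : Multiset ℕ} (h : ¬ IsReduced s) :
    ∃ s', Step s s' := by
  simp only [IsReduced, not_forall] at h
  obtain ⟨b, hb, h⟩ := h
  have hs := Multiset.cons_erase hb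
  by_cases h1 : b ∈ natSpan (s.erase b)
  · exact ⟨_, hs ▸ Step.removeMem b _ h1⟩
  by_cases h2 : (b : ℚ) ∈ ratSpan (s.erase b)
  · refine ⟨index b (s.erase b) * b ::ₘ s.erase b, ?_⟩
    have := Step.scale b (s.erase b) h2 (fun h3 => h ⟨?_, h1⟩)
    · rwa [hs] at this
    · rw [mem_intSpan, Int.natCast_dvd_natCast]
      have := ((index_spec h2).2 1).2 (by rw [h3])
      simpa using this
  · exact ⟨_, hs ▸ Step.removeIndep b _ h2⟩

theorem IsReduced.not_step {s s' : Multiset ℕ} (h : IsReduced s) : ¬ Step s s' := by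
  intro hs
  cases hs with
  | removeIndep b t hb =>
    have := (h b (by simp)).1
    rw [Multiset.erase_cons_head, mem_intSpan, Int.natCast_dvd_natCast] at this
    rw [mem_ratSpan] at hb
    push Not at hb
    rw [hb.2, Nat.zero_dvd] at this
    exact hb.1 this
  | removeMem b t hb =>
    have := (h b (by simp)).2
    rw [Multiset.erase_cons_head] at this
    exact this hb
  | scale b t hb hB =>
    have := (h b (by simp)).1
    rw [Multiset.erase_cons_head, mem_intSpan, Int.natCast_dvd_natCast] at this
    have h2 := ((index_spec hb).2 1).1 (by simpa using this)
    exact hB (Nat.dvd_one.1 h2)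

theorem gcd_scale {b : ℕ} {t : Multiset ℕ} (hb : (b : ℚ) ∈ ratSpan t) :
    (index b t * b ::ₘ t).gcd = index b t * (b ::ₘ t).gcd := by
  obtain ⟨hpos, h⟩ := index_spec hb
  have h1 : t.gcd ∣ index b t * b := (h _).2 dvd_rfl
  rw [Multiset.gcd_cons, Multiset.gcd_cons]
  change Nat.gcd _ _ = _ * Nat.gcd _ _
  rw [Nat.gcd_eq_right h1]
  refine Nat.dvd_antisymm ?_ ?_
  · rw [← Nat.gcd_mul_left]
    exact Nat.dvd_gcd h1 (Dvd.intro_left _ rfl)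
  · rcases Nat.eq_zero_or_pos t.gcd with h0 | h0
    · rw [h0]; simp
    have hg : 0 < Nat.gcd b t.gcd := Nat.gcd_pos_of_pos_right _ h0
    obtain ⟨q, hq⟩ := Nat.gcd_dvd_right b t.gcd
    obtain ⟨b', hb'⟩ := Nat.gcd_dvd_left b t.gcd
    have : index b t ∣ q := (h q).1 ⟨b', by
      conv_lhs => rw [hb']
      conv_rhs => rw [hq]
      ring⟩
    conv_rhs => rw [hq, mul_comm]
    exact Nat.mul_dvd_mul_right this _

/-- A measure that decreases along reduction steps. -/
def measure (s : Multiset ℕ) : ℕ ×ₗ ℕ :=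
  toLex (s.card, (s.map (fun x => x / s.gcd)).sum)

theorem Step.measure_lt {s s' : Multiset ℕ} (h : Step s s') : measure s' < measure s := by
  cases h with
  | removeIndep b _ => exact Prod.Lex.toLex_lt_toLex.2 (Or.inl (by simp))
  | removeMem b _ => exact Prod.Lex.toLex_lt_toLex.2 (Or.inl (by simp))
  | scale b t hb hB =>
    refine Prod.Lex.toLex_lt_toLex.2 (Or.inr ⟨by simp, ?_⟩)
    have hpos := (index_spec hb).1
    simp only [gcd_scale hb, Multiset.map_cons, Multiset.sum_cons]
    rw [Nat.mul_div_mul_left _ _ hpos]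
    refine Nat.add_lt_add_left ?_ _
    have hG : t.gcd ≠ 0 := by
      intro h0
      have hb0 : b = 0 := by
        rw [mem_ratSpan] at hb
        exact hb.resolve_right (not_not.2 h0)
      exact hB (index_eq_of one_pos (by simp [hb0]))
    obtain ⟨x, hx, hx0⟩ := (Multiset.gcd_ne_zero_iff t).1 hG
    refine Multiset.sum_lt_sum (fun y _ => ?_) ⟨x, hx, ?_⟩
    · rw [mul_comm, ← Nat.div_div_eq_div_mul]
      exact Nat.div_le_self _ _
    · rw [mul_comm, ← Nat.div_div_eq_div_mul]
      have hd : (b ::ₘ t).gcd ∣ x := Multiset.gcd_dvd (by simp [hx])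
      have hx1 : 0 < x / (b ::ₘ t).gcd := Nat.div_pos
        (Nat.le_of_dvd (Nat.pos_of_ne_zero hx0) hd)
        (Nat.pos_of_dvd_of_pos hd (Nat.pos_of_ne_zero hx0))
      exact Nat.div_lt_self hx1 (by omega)

theorem exists_isReductionOf (s : Multiset ℕ) : ∃ r, IsReductionOf s r := by
  induction s using (InvImage.wf measure wellFounded_lt).induction with
  | _ s ih =>
    by_cases h : IsReduced s
    · exact ⟨s, .refl, h⟩
    · obtain ⟨s', hs⟩ := exists_step_of_not_isReduced h
      obtain ⟨r, hr, hr'⟩ := ih s' hs.measure_lt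
      exact ⟨r, .head hs hr, hr'⟩

/-- Joinability: the two multisets have a common iterated reduction. -/
def Joins (u v : Multiset ℕ) : Prop := Relation.Join (Relation.ReflTransGen Step) u v

theorem Joins.symm {u v : Multiset ℕ} (h : Joins u v) : Joins v u := by
  obtain ⟨x, h1, h2⟩ := h
  exact ⟨x, h2, h1⟩

theorem scale_reflTransGen {b : ℕ} {t : Multiset ℕ} (hb : (b : ℚ) ∈ ratSpan t) :
    Relation.ReflTransGen Step (b ::ₘ t) ((index b t * b) ::ₘ t) := by
  by_cases h : index b t = 1
  · rw [h, one_mul]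
  · exact .single (.scale b t hb h)

theorem gcd_cons' (a : ℕ) (t : Multiset ℕ) : (a ::ₘ t).gcd = Nat.gcd a t.gcd :=
  Multiset.gcd_cons a t

theorem joins_indep {b c : ℕ} {w u : Multiset ℕ} (hb : (b : ℚ) ∉ ratSpan (c ::ₘ w))
    (hu : u = b ::ₘ w ∧ (c : ℚ) ∉ ratSpan (b ::ₘ w) ∨ u = b ::ₘ w ∧ c ∈ natSpan (b ::ₘ w) ∨
      u = (index c (b ::ₘ w) * c) ::ₘ b ::ₘ w ∧ (c : ℚ) ∈ ratSpan (b ::ₘ w) ∧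
        index c (b ::ₘ w) ≠ 1) : Joins (c ::ₘ w) u := by
  rw [mem_ratSpan, gcd_cons'] at hb
  push Not at hb
  obtain ⟨hb0, hg⟩ := hb
  obtain ⟨rfl, hw⟩ := Nat.gcd_eq_zero_iff.1 hg
  rcases hu with ⟨_, h⟩ | ⟨rfl, _⟩ | ⟨_, _, h⟩
  · exact absurd (by simp) h
  · refine ⟨w, .single (.removeMem _ _ (zero_mem _)), .single (.removeIndep _ _ ?_)⟩
    rw [mem_ratSpan]
    simp [hb0, hw]
  · exact absurd (index_eq_of one_pos (by simp)) h

theorem joins_mem_mem {b c : ℕ} {w : Multiset ℕ} (hb : b ∈ natSpan (c ::ₘ w))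
    (hc : c ∈ natSpan (b ::ₘ w)) : Joins (c ::ₘ w) (b ::ₘ w) := by
  obtain ⟨α, y, hy, e1⟩ := (mem_natSpan_cons _ _ _).1 hb
  obtain ⟨β, z, hz, e2⟩ := (mem_natSpan_cons _ _ _).1 hc
  by_cases hβ : β = 0
  · have hc' : c ∈ natSpan w := by rw [e2, hβ]; simpa using hz
    have hb' : b ∈ natSpan w := by
      rw [e1]
      exact add_mem (by simpa using nsmul_mem hc' α) hy
    exact ⟨w, .single (.removeMem _ _ hc'), .single (.removeMem _ _ hb')⟩
  by_cases hα : α = 0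
  · have hb' : b ∈ natSpan w := by rw [e1, hα]; simpa using hy
    have hc' : c ∈ natSpan w := by
      rw [e2]
      exact add_mem (by simpa using nsmul_mem hb' β) hz
    exact ⟨w, .single (.removeMem _ _ hc'), .single (.removeMem _ _ hb')⟩
  have hcb : c ≤ b := by
    rw [e1]
    nlinarith [Nat.pos_of_ne_zero hα]
  have hbc : b ≤ c := by
    rw [e2]
    nlinarith [Nat.pos_of_ne_zero hβ]
  rw [le_antisymm hbc hcb]
  exact ⟨_, .refl, .refl⟩

theorem joins_mem_scale {b c : ℕ} {w : Multiset ℕ} (hb : b ∈ natSpan (c ::ₘ w))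
    (hc : (c : ℚ) ∈ ratSpan (b ::ₘ w)) :
    Joins (c ::ₘ w) ((index c (b ::ₘ w) * c) ::ₘ b ::ₘ w) := by
  obtain ⟨hB, hspec⟩ := index_spec hc
  set B := index c (b ::ₘ w) with hBdef
  obtain ⟨α, y, hy, e1⟩ := (mem_natSpan_cons _ _ _).1 hb
  have hgy := gcd_dvd_of_mem_natSpan hy
  have hBα : B ∣ α := by
    rw [← hspec, gcd_cons']
    refine (Nat.dvd_add_left ((Nat.gcd_dvd_right b w.gcd).trans hgy)).1 ?_
    rw [← e1]
    exact Nat.gcd_dvd_left _ _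
  obtain ⟨a, rfl⟩ := hBα
  have s1 : Step ((B * c) ::ₘ b ::ₘ w) ((B * c) ::ₘ w) := by
    rw [Multiset.cons_swap]
    refine .removeMem _ _ ((mem_natSpan_cons _ _ _).2 ⟨a, y, hy, ?_⟩)
    rw [e1]; ring
  by_cases hcw : (c : ℚ) ∈ ratSpan w
  · obtain ⟨hB', hspec'⟩ := index_spec hcw
    have hdvd : B ∣ index c w := by
      rw [← hspec, gcd_cons']
      exact (Nat.gcd_dvd_right _ _).trans ((hspec' _).2 dvd_rfl)
    obtain ⟨q, hq⟩ := hdvd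
    have hq0 : 0 < q := Nat.pos_of_ne_zero (by rintro rfl; simp at hq; omega)
    have hidx : index (B * c) w = q := by
      refine index_eq_of hq0 (fun x => ?_)
      rw [show x * (B * c) = (B * x) * c by ring, hspec', hq, Nat.mul_dvd_mul_iff_left hB]
    have hBc : ((B * c : ℕ) : ℚ) ∈ ratSpan w := by
      rw [mem_ratSpan] at hcw ⊢
      rcases hcw with rfl | h
      · simp
      · exact Or.inr h
    refine ⟨(index c w * c) ::ₘ w, scale_reflTransGen hcw, .head s1 ?_⟩
    have := scale_reflTransGen hBc
    rwa [hidx, show q * (B * c) = index c w * c by rw [hq]; ring] at this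
  · refine ⟨w, .single (.removeIndep _ _ hcw), .head s1 (.single (.removeIndep _ _ ?_))⟩
    rw [mem_ratSpan] at hcw ⊢
    push Not at hcw ⊢
    exact ⟨mul_ne_zero hB.ne' hcw.1, hcw.2⟩

theorem index_scale {b c : ℕ} {w : Multiset ℕ} (hb : (b : ℚ) ∈ ratSpan (c ::ₘ w))
    (hc : (c : ℚ) ∈ ratSpan (b ::ₘ w)) :
    (c : ℚ) ∈ ratSpan ((index b (c ::ₘ w) * b) ::ₘ w) ∧
      index c ((index b (c ::ₘ w) * b) ::ₘ w) = index c (b ::ₘ w) := by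
  obtain ⟨hB, hspec⟩ := index_spec hb
  have hspecZ := index_spec_int hb
  set B := index b (c ::ₘ w) with hBdef
  refine ⟨?_, index_eq_of (index_spec hc).1 (fun x => ?_)⟩
  · rw [mem_ratSpan, gcd_cons'] at hc ⊢
    refine hc.imp_right (fun h h' => h ?_)
    rw [Nat.gcd_eq_zero_iff] at h' ⊢
    exact ⟨(mul_eq_zero.1 h'.1).resolve_left hB.ne', h'.2⟩
  · rw [← (index_spec hc).2 x, gcd_cons', gcd_cons']
    refine ⟨fun h => dvd_trans (Nat.dvd_gcd ?_ (Nat.gcd_dvd_right _ _)) h, fun h => ?_⟩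
    · exact (Nat.gcd_dvd_left _ _).trans (Dvd.intro_left _ rfl)
    · obtain ⟨q, hq⟩ := h
      have hbez := Nat.gcd_eq_gcd_ab b w.gcd
      have e : ((x * c : ℕ) : ℤ) =
          (q * Nat.gcdA b w.gcd) * b + w.gcd * (q * Nat.gcdB b w.gcd) := by
        rw [hq]; push_cast; rw [hbez]; ring
      have hBd : (B : ℤ) ∣ q * Nat.gcdA b w.gcd := by
        rw [← hspecZ, gcd_cons']
        have : (q * Nat.gcdA b w.gcd : ℤ) * b =
            x * c - w.gcd * (q * Nat.gcdB b w.gcd) := by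
          push_cast at e; linarith
        rw [this]
        refine dvd_sub (Dvd.dvd.mul_left ?_ _) (Dvd.dvd.mul_right ?_ _)
        · exact_mod_cast Nat.gcd_dvd_left c w.gcd
        · exact_mod_cast Nat.gcd_dvd_right c w.gcd
      rw [← Int.natCast_dvd_natCast, e]
      refine dvd_add ?_ (Dvd.dvd.mul_right ?_ _)
      · refine dvd_trans (b := ((B * b : ℕ) : ℤ)) ?_ ?_
        · exact_mod_cast Nat.gcd_dvd_left _ _
        · push_cast
          exact mul_dvd_mul_right hBd _
      · exact_mod_cast Nat.gcd_dvd_right _ _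

theorem joins_scale_scale {b c : ℕ} {w : Multiset ℕ} (hb : (b : ℚ) ∈ ratSpan (c ::ₘ w))
    (hc : (c : ℚ) ∈ ratSpan (b ::ₘ w)) :
    Joins ((index b (c ::ₘ w) * b) ::ₘ c ::ₘ w) ((index c (b ::ₘ w) * c) ::ₘ b ::ₘ w) := by
  obtain ⟨h1, h2⟩ := index_scale hb hc
  obtain ⟨h3, h4⟩ := index_scale hc hb
  refine ⟨(index b (c ::ₘ w) * b) ::ₘ (index c (b ::ₘ w) * c) ::ₘ w, ?_, ?_⟩
  · have := scale_reflTransGen h1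
    rwa [h2, Multiset.cons_swap, Multiset.cons_swap (_ * c)] at this
  · have := scale_reflTransGen h3
    rwa [h4, Multiset.cons_swap] at this

theorem step_iff {s u : Multiset ℕ} : Step s u ↔ ∃ b t, s = b ::ₘ t ∧
    (u = t ∧ (b : ℚ) ∉ ratSpan t ∨ u = t ∧ b ∈ natSpan t ∨
      u = (index b t * b) ::ₘ t ∧ (b : ℚ) ∈ ratSpan t ∧ index b t ≠ 1) := by
  constructor
  · rintro (⟨b, t, h⟩ | ⟨b, t, h⟩ | ⟨b, t, h, h'⟩)
    · exact ⟨b, _, rfl, Or.inl ⟨rfl, h⟩⟩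
    · exact ⟨b, _, rfl, Or.inr (Or.inl ⟨rfl, h⟩)⟩
    · exact ⟨b, t, rfl, Or.inr (Or.inr ⟨rfl, h, h'⟩)⟩
  · rintro ⟨b, t, rfl, ⟨rfl, h⟩ | ⟨rfl, h⟩ | ⟨rfl, h, h'⟩⟩
    · exact .removeIndep _ _ h
    · exact .removeMem _ _ h
    · exact .scale _ _ h h'

theorem index_eq_one_of_mem_natSpan {b : ℕ} {t : Multiset ℕ} (h : b ∈ natSpan t) :
    index b t = 1 :=
  index_eq_of one_pos (fun x => by
    simpa using (gcd_dvd_of_mem_natSpan h).mul_left x)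

theorem local_confluence {s u v : Multiset ℕ} (su : Step s u) (sv : Step s v) : Joins u v := by
  obtain ⟨b, t, rfl, hu⟩ := step_iff.1 su
  obtain ⟨c, t', e, hv⟩ := step_iff.1 sv
  rcases Multiset.cons_eq_cons.1 e with ⟨rfl, rfl⟩ | ⟨-, w, rfl, rfl⟩
  · rcases hu with ⟨rfl, h1⟩ | ⟨rfl, h1⟩ | ⟨rfl, h1, h2⟩ <;>
      rcases hv with ⟨rfl, h3⟩ | ⟨rfl, h3⟩ | ⟨rfl, h3, h4⟩
    all_goals first
      | exact ⟨_, .refl, .refl⟩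
      | exact absurd h3 h1
      | exact absurd h1 h3
      | exact absurd (index_eq_one_of_mem_natSpan h1) h4
      | exact absurd (index_eq_one_of_mem_natSpan h3) h2
  · rcases hu with ⟨rfl, h1⟩ | ⟨rfl, h1⟩ | ⟨rfl, h1, h2⟩
    · exact joins_indep h1 hv
    · rcases hv with ⟨rfl, h3⟩ | ⟨rfl, h3⟩ | ⟨rfl, h3, h4⟩
      · exact (joins_indep h3 (Or.inr (Or.inl ⟨rfl, h1⟩))).symm
      · exact joins_mem_mem h1 h3
      · exact joins_mem_scale h1 h3
    · rcases hv with ⟨rfl, h3⟩ | ⟨rfl, h3⟩ | ⟨rfl, h3, h4⟩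
      · exact (joins_indep h3 (Or.inr (Or.inr ⟨rfl, h1, h2⟩))).symm
      · exact (joins_mem_scale h3 h1).symm
      · exact joins_scale_scale h1 h3

theorem IsReduced.eq_of_reflTransGen {r r' : Multiset ℕ} (h : IsReduced r)
    (hr : Relation.ReflTransGen Step r r') : r' = r := by
  rcases Relation.ReflTransGen.cases_head hr with h1 | ⟨c, hc, _⟩
  · exact h1.symm
  · exact absurd hc h.not_step

theorem isReductionOf_unique (s : Multiset ℕ) : ∀ r r' : Multiset ℕ,
    IsReductionOf s r → IsReductionOf s r' → r = r' := by
  induction s using (InvImage.wf measure wellFounded_lt).induction with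
  | _ s ih =>
    rintro r r' ⟨hr, hr1⟩ ⟨hr', hr1'⟩
    rcases Relation.ReflTransGen.cases_head hr with rfl | ⟨u, hu, hur⟩
    · exact (hr1.eq_of_reflTransGen hr').symm
    rcases Relation.ReflTransGen.cases_head hr' with rfl | ⟨v, hv, hvr⟩
    · exact hr1'.eq_of_reflTransGen hr
    obtain ⟨x, hux, hvx⟩ := local_confluence hu hv
    obtain ⟨y, hxy, hy⟩ := exists_isReductionOf x
    rw [ih u hu.measure_lt r y ⟨hur, hr1⟩ ⟨hux.trans hxy, hy⟩,
      ih v hv.measure_lt r' y ⟨hvr, hr1'⟩ ⟨hvx.trans hxy, hy⟩]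

theorem existsUnique_isReductionOf (s : Multiset ℕ) : ∃! r, IsReductionOf s r := by
  obtain ⟨r, hr⟩ := exists_isReductionOf s
  exact ⟨r, hr, fun r' hr' => isReductionOf_unique s r' r hr' hr⟩

end CIReduction

/-- The unique reduced multiset that is obtained from `s` by iterated reduction steps. -/
noncomputable def reducedSet (s : Multiset ℕ) : Multiset ℕ :=
  Classical.choose (CIReduction.existsUnique_isReductionOf s)

theorem reducedSet_eq_iff (s r : Multiset ℕ) :
    reducedSet s = r ↔ CIReduction.IsReductionOf s r := by
  have h := Classical.choose_spec (CIReduction.existsUnique_isReductionOf s)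
  exact ⟨fun e => e ▸ h.1, fun hr => (h.2 r hr).symm⟩

/-! Write 𝔪 for the ideal of the origin. The toric ideal I is a prime of height one less than the
number of variables (`height_toricIdeal`), so by Krull's theorem it is a complete intersection
exactly when it can be generated by that many elements.

If the family reduces to ∅, read the reduction backwards (`hasFewRelations_of_reflTransGen`).
Restoring a weight that lies in the semigroup of the others costs one new relation `xᵢ ~ x ^ M`.
Undoing a scaling by `B` costs none: two monomials of equal weight have `xᵢ`-exponents congruent mod
`B`, so after a common power of `xᵢ` is split off both are monomials in `xᵢ ^ B` and the other
variables. The last weight needs no relation. The resulting pairs of exponents give binomials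
generating I.

Conversely, let I be a complete intersection and choose critical binomials `fᵢ = xᵢ ^ mᵢ - x ^ Mᵢ`.
The coefficient of `xᵢ ^ mᵢ` vanishes on 𝔪I (`coeff_critMult_eq_zero`). Since the critical degrees
with `i ≠ i₀` are distinct, these functionals are dual to the `fᵢ`, which therefore form a basis of
I/𝔪I and, by graded Nakayama, generate I (`toricIdeal_eq_span_critical`). Krull's theorem then
forces a triangular order of the variables, starting with `i₀`, in which `x ^ Mᵢ` uses only
variables before `xᵢ` (`exists_forall_eq_zero_of_span_eq`). The exponent vectors of the `fᵢ` span
the lattice of relations, so for the last variable `mᵢ` divides the index `Bᵢ`. Hence `Bᵢ dᵢ` lies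
in the semigroup of the earlier weights: scale, remove, and repeat (`IsTriangular.reflTransGen`). -/

/-! ### Binomials in the toric ideal -/

open MvPolynomial in
theorem aeval_pow_monomial (k : Type*) [Field k] {n : ℕ} (d : Fin n → ℕ) (u : Fin n →₀ ℕ) (c : k) :
    aeval (R := k) (fun i => (Polynomial.X : Polynomial k) ^ d i) (monomial u c) =
      Polynomial.monomial (Finsupp.weight d u) c := by
  rw [aeval_monomial, ← Polynomial.C_mul_X_pow_eq_monomial, Finsupp.weight_apply, Finsupp.sum,
    ← Finset.prod_pow_eq_pow_sum, Finsupp.prod, Polynomial.algebraMap_eq]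
  congr 1
  refine Finset.prod_congr rfl fun i _ => ?_
  rw [← pow_mul, smul_eq_mul, mul_comm]

open MvPolynomial in
theorem binomial_mem_toricIdeal (k : Type*) [Field k] {n : ℕ} {d : Fin n → ℕ} {u v : Fin n →₀ ℕ}
    (h : Finsupp.weight d u = Finsupp.weight d v) :
    (monomial u 1 - monomial v 1 : MvPolynomial (Fin n) k) ∈ toricIdeal k d := by
  rw [toricIdeal, RingHom.mem_ker, map_sub]
  rw [aeval_pow_monomial, aeval_pow_monomial, h, sub_self]

open MvPolynomial in
/-- The toric ideal is generated by its binomials. -/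
theorem toricIdeal_le_of_binomial_mem (k : Type*) [Field k] {n : ℕ} (d : Fin n → ℕ)
    (J : Ideal (MvPolynomial (Fin n) k))
    (h : ∀ u v : Fin n →₀ ℕ, Finsupp.weight d u = Finsupp.weight d v →
      (monomial u 1 - monomial v 1 : MvPolynomial (Fin n) k) ∈ J) : toricIdeal k d ≤ J := by
  classical
  -- `ψ` sends `t ^ D` to the class of one chosen monomial of weight `D` (0 if there is none).
  -- Monomials of equal weight agree modulo `J`, so the quotient map factors through the
  -- parametrization.
  let ψ : Polynomial k →ₗ[k] (MvPolynomial (Fin n) k ⧸ J) :=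
    (Polynomial.basisMonomials k).constr k fun D =>
      if hD : ∃ u : Fin n →₀ ℕ, Finsupp.weight d u = D then
        Ideal.Quotient.mk J (monomial hD.choose 1) else 0
  have key : ψ ∘ₗ (aeval (R := k) (fun i => (Polynomial.X : Polynomial k) ^ d i)).toLinearMap =
      (Ideal.Quotient.mkₐ k J).toLinearMap := by
    refine (basisMonomials (Fin n) k).ext fun u => ?_
    have hD : ∃ v : Fin n →₀ ℕ, Finsupp.weight d v = Finsupp.weight d u := ⟨u, rfl⟩
    have e : ψ (Polynomial.monomial (Finsupp.weight d u) 1) =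
        Ideal.Quotient.mk J (monomial hD.choose 1) := by
      have h1 := (Polynomial.basisMonomials k).constr_basis k (fun D =>
        if hD : ∃ u : Fin n →₀ ℕ, Finsupp.weight d u = D then
          Ideal.Quotient.mk J (monomial hD.choose 1) else 0) (Finsupp.weight d u)
      rwa [Polynomial.coe_basisMonomials, dif_pos hD] at h1
    simp only [coe_basisMonomials, LinearMap.comp_apply, AlgHom.toLinearMap_apply,
      aeval_pow_monomial, e, Ideal.Quotient.mkₐ_eq_mk]
    exact Ideal.Quotient.eq.2 (h _ _ hD.choose_spec)
  intro g hg
  have hg' : aeval (R := k) (fun i => (Polynomial.X : Polynomial k) ^ d i) g = 0 := hg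
  have := LinearMap.congr_fun key g
  simp only [LinearMap.comp_apply, AlgHom.toLinearMap_apply, hg', map_zero,
    Ideal.Quotient.mkₐ_eq_mk] at this
  exact Ideal.Quotient.eq_zero_iff_mem.1 this.symm

/-! ### Heights of the toric ideal and of the origin -/

instance toricIdeal_isPrime (k : Type*) [Field k] {n : ℕ} (d : Fin n → ℕ) :
    (toricIdeal k d).IsPrime := RingHom.ker_isPrime _

open MvPolynomial in
theorem ker_constantCoeff_eq_span (k : Type*) [Field k] (n : ℕ) :
    RingHom.ker (constantCoeff : MvPolynomial (Fin n) k →+* k) = Ideal.span (Set.range X) := by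
  ext p
  rw [← Set.image_univ, mem_ideal_span_X_image, RingHom.mem_ker, constantCoeff_eq]
  constructor
  · intro h m hm
    by_contra! hc
    have : m = 0 := Finsupp.ext fun i => hc i trivial
    exact mem_support_iff.1 hm (this ▸ h)
  · intro h
    by_contra hc
    obtain ⟨i, -, hi⟩ := h 0 (mem_support_iff.2 hc)
    exact hi rfl

open MvPolynomial in
theorem X_mem_ker_constantCoeff (k : Type*) [Field k] {n : ℕ} (i : Fin n) :
    (X i : MvPolynomial (Fin n) k) ∈ RingHom.ker (constantCoeff : MvPolynomial (Fin n) k →+* k) := by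
  simp [RingHom.mem_ker]

open MvPolynomial in
theorem height_ker_constantCoeff_le (k : Type*) [Field k] (n : ℕ) :
    (RingHom.ker (constantCoeff : MvPolynomial (Fin n) k →+* k)).height ≤ n := by
  have h := Ideal.height_le_spanFinrank (RingHom.ker (constantCoeff : MvPolynomial (Fin n) k →+* k))
    (RingHom.ker_ne_top _)
  refine h.trans ?_
  rw [ker_constantCoeff_eq_span]
  refine (Submodule.spanFinrank_span_le_encard _).trans ?_
  rw [← Set.image_univ]
  refine (Set.encard_image_le _ _).trans ?_
  simp

theorem weight_eq_zero_iff_of_pos {n : ℕ} {d : Fin n → ℕ} (hpos : ∀ i, 0 < d i)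
    (u : Fin n →₀ ℕ) : Finsupp.weight d u = 0 ↔ u = 0 := by
  have : Finsupp.NonTorsionWeight ℕ d :=
    Finsupp.nonTorsionWeight_of (w := d) (R := ℕ) (fun i => (hpos i).ne')
  exact Finsupp.weight_eq_zero_iff_eq_zero d

-- With positive weights only the monomial 1 has weight 0, so the constant terms of a homogeneous
-- binomial cancel.
open MvPolynomial in
theorem toricIdeal_le_ker_constantCoeff (k : Type*) [Field k] {n : ℕ} {d : Fin n → ℕ}
    (hpos : ∀ i, 0 < d i) :
    toricIdeal k d ≤ RingHom.ker (constantCoeff : MvPolynomial (Fin n) k →+* k) := by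
  refine toricIdeal_le_of_binomial_mem k d _ fun u v huv => ?_
  rw [RingHom.mem_ker, map_sub, constantCoeff_monomial, constantCoeff_monomial]
  have : u = 0 ↔ v = 0 := by
    rw [← weight_eq_zero_iff_of_pos hpos u, ← weight_eq_zero_iff_of_pos hpos v, huv]
  simp [this]

open MvPolynomial in
/-- Together with one variable, the toric ideal is primary to the origin. -/
theorem ker_constantCoeff_le_of_toricIdeal_le (k : Type*) [Field k] {n : ℕ} {d : Fin n → ℕ}
    (hpos : ∀ i, 0 < d i) {p : Ideal (MvPolynomial (Fin n) k)} (hp : p.IsPrime)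
    (hI : toricIdeal k d ≤ p) {j : Fin n} (hj : X j ∈ p) :
    RingHom.ker (constantCoeff : MvPolynomial (Fin n) k →+* k) ≤ p := by
  rw [ker_constantCoeff_eq_span, Ideal.span_le]
  rintro _ ⟨i, rfl⟩
  -- Modulo this binomial, a power of any other variable is a power of `X j`.
  have h1 : (X i ^ d j - X j ^ d i : MvPolynomial (Fin n) k) ∈ toricIdeal k d := by
    rw [X_pow_eq_monomial, X_pow_eq_monomial]
    refine binomial_mem_toricIdeal k ?_
    simp [Finsupp.weight_single, mul_comm]
  have h2 : (X i ^ d j : MvPolynomial (Fin n) k) ∈ p := by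
    have := add_mem (hI h1) (Ideal.pow_mem_of_mem p hj _ (hpos i))
    simpa using this
  exact hp.mem_of_pow_mem _ h2

-- The kernels of `φ 0, …, φ n` form a strictly increasing chain of primes inside the toric ideal:
-- `φ j` substitutes `X 0 ^ d i` for the variables of index at most `j`, and `ε j` performs the next
-- substitution.
open MvPolynomial in
theorem le_height_toricIdeal (k : Type*) [Field k] {n : ℕ} (d : Fin (n + 1) → ℕ)
    (hpos : ∀ i, 0 < d i) : (n : ℕ∞) ≤ (toricIdeal k d).height := by
  let φ : ℕ → (MvPolynomial (Fin (n + 1)) k →ₐ[k] MvPolynomial (Fin (n + 1)) k) := fun j =>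
    aeval fun i => if i.1 ≤ j then X 0 ^ d i else X i
  let ε : ℕ → (MvPolynomial (Fin (n + 1)) k →ₐ[k] MvPolynomial (Fin (n + 1)) k) := fun j =>
    aeval fun i => if i.1 = j + 1 then X 0 ^ d i else X i
  have hφ : ∀ j, (ε j).comp (φ j) = φ (j + 1) := fun j => by
    refine algHom_ext fun i => ?_
    simp only [φ, ε, AlgHom.comp_apply, aeval_X]
    by_cases h1 : i.1 ≤ j
    · simp [h1, h1.trans (Nat.le_succ j)]
    · by_cases h2 : i.1 = j + 1
      · simp [h2]
      · have h3 : ¬ i.1 ≤ j + 1 := by omega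
        simp [h1, h2, h3]
  have hstep : ∀ j, j ≤ n → (j : ℕ∞) ≤ (RingHom.ker (φ j)).height := by
    intro j
    induction j with
    | zero => simp
    | succ j ih =>
      intro hj
      have hlt : RingHom.ker (φ j) < RingHom.ker (φ (j + 1)) := by
        refine lt_of_le_of_ne (fun p hp => ?_) fun he => ?_
        · have hp' : φ j p = 0 := hp
          have : φ (j + 1) p = 0 := by rw [← hφ, AlgHom.comp_apply, hp', map_zero]
          exact this
        · let i : Fin (n + 1) := ⟨j + 1, by omega⟩
          have h1 : (X i ^ d 0 - X 0 ^ d i : MvPolynomial (Fin (n + 1)) k) ∈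
              RingHom.ker (φ (j + 1)) := by
            rw [RingHom.mem_ker]
            simp [φ, i, ← pow_mul, mul_comm]
          rw [← he, RingHom.mem_ker] at h1
          have h2 : (X i ^ d 0 : MvPolynomial (Fin (n + 1)) k) = X 0 ^ (d 0 * d i) := by
            simpa [φ, i, ← pow_mul, sub_eq_zero] using h1
          -- At `X i = 0` with all other variables 1, the equation reads `0 = 1`.
          have h3 := congrArg (aeval (R := k) (fun l : Fin (n + 1) => if l = i then (0 : k) else 1)) h2
          have hi : (0 : Fin (n + 1)) ≠ i := by simp [i, Fin.ext_iff]
          simp [hi, (hpos 0).ne'] at h3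
      have : (RingHom.ker (φ j)).IsPrime := RingHom.ker_isPrime _
      have : (RingHom.ker (φ (j + 1))).IsPrime := RingHom.ker_isPrime _
      push_cast
      exact (add_le_add_left (ih (by omega)) 1).trans
        (Ideal.height_add_one_le_of_lt_of_isPrime hlt)
  refine (hstep n le_rfl).trans (Ideal.height_mono fun p hp => ?_)
  have hc : (aeval (R := k) (fun _ : Fin (n + 1) => (Polynomial.X : Polynomial k))).comp (φ n) =
      aeval (R := k) (fun i => (Polynomial.X : Polynomial k) ^ d i) := by
    refine algHom_ext fun i => ?_
    have : i.1 ≤ n := by omega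
    simp [φ, this]
  have hp' : φ n p = 0 := hp
  rw [toricIdeal, RingHom.mem_ker, ← hc, AlgHom.comp_apply, hp', map_zero]

open MvPolynomial in
theorem height_toricIdeal_add_one_le (k : Type*) [Field k] {n : ℕ} (d : Fin (n + 1) → ℕ)
    (hpos : ∀ i, 0 < d i) : (toricIdeal k d).height + 1 ≤
      (RingHom.ker (constantCoeff : MvPolynomial (Fin (n + 1)) k →+* k)).height := by
  have : (RingHom.ker (constantCoeff : MvPolynomial (Fin (n + 1)) k →+* k)).IsPrime :=
    RingHom.ker_isPrime _
  refine Ideal.height_add_one_le_of_lt_of_isPrime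
    (lt_of_le_of_ne (toricIdeal_le_ker_constantCoeff k hpos) fun he => ?_)
  have := X_mem_ker_constantCoeff k (0 : Fin (n + 1))
  rw [← he, toricIdeal, RingHom.mem_ker] at this
  simp at this

theorem height_toricIdeal (k : Type*) [Field k] {n : ℕ} (d : Fin (n + 1) → ℕ)
    (hpos : ∀ i, 0 < d i) : (toricIdeal k d).height = n := by
  refine le_antisymm ?_ (le_height_toricIdeal k d hpos)
  have h := (height_toricIdeal_add_one_le k d hpos).trans (height_ker_constantCoeff_le k (n + 1))
  push_cast at h
  exact (ENat.add_le_add_iff_right ENat.one_ne_top).1 h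

-- With all weights 1, the toric ideal has height `n` and lies strictly below the origin.
open MvPolynomial in
theorem le_height_ker_constantCoeff (k : Type*) [Field k] (n : ℕ) : ((n + 1 : ℕ) : ℕ∞) ≤
    (RingHom.ker (constantCoeff : MvPolynomial (Fin (n + 1)) k →+* k)).height := by
  have h := height_toricIdeal_add_one_le k (fun _ : Fin (n + 1) => 1) (by simp)
  rw [height_toricIdeal _ _ (by simp)] at h
  exact_mod_cast h

/-! ### From a reduction to ∅ to few generators -/

open CIReduction in
theorem mem_natSpan_map_iff {n : ℕ} (w : Fin n → ℕ) (S : Finset (Fin n)) (x : ℕ) :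
    x ∈ natSpan (S.val.map w) ↔
      ∃ u : Fin n →₀ ℕ, u.support ⊆ S ∧ Finsupp.weight w u = x := by
  classical
  constructor
  · intro h
    refine AddSubmonoid.closure_induction
      (motive := fun x _ => ∃ u : Fin n →₀ ℕ, u.support ⊆ S ∧ Finsupp.weight w u = x) ?_ ?_ ?_ h
    · intro y hy
      obtain ⟨i, hi, rfl⟩ := Multiset.mem_map.1 hy
      refine ⟨Finsupp.single i 1, Finsupp.support_single_subset.trans (by simpa using hi), ?_⟩
      simp [Finsupp.weight_single]
    · exact ⟨0, by simp, by simp⟩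
    · rintro x y _ _ ⟨u, hu, rfl⟩ ⟨v, hv, rfl⟩
      exact ⟨u + v, Finsupp.support_add.trans (Finset.union_subset hu hv), by simp⟩
  · rintro ⟨u, hu, rfl⟩
    rw [Finsupp.weight_apply, Finsupp.sum]
    refine sum_mem fun i hi => nsmul_mem (AddSubmonoid.subset_closure ?_) _
    exact Multiset.mem_map_of_mem _ (hu hi)

theorem weight_eq_sum_of_support_subset {n : ℕ} (w : Fin n → ℕ) {S : Finset (Fin n)}
    {u : Fin n →₀ ℕ} (hu : u.support ⊆ S) : Finsupp.weight w u = ∑ l ∈ S, u l * w l := by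
  rw [Finsupp.weight_apply]
  exact Finsupp.sum_of_support_subset u hu _ (by simp)

/-- The pairs of exponents of weight-homogeneous binomials in the variables of `S` are identified
by every congruence that contains some `#S - 1` such pairs. -/
def HasFewRelations {n : ℕ} (S : Finset (Fin n)) (w : Fin n → ℕ) : Prop :=
  ∃ F : Finset ((Fin n →₀ ℕ) × (Fin n →₀ ℕ)), F.card ≤ S.card - 1 ∧
    (∀ p ∈ F, Finsupp.weight w p.1 = Finsupp.weight w p.2) ∧
    ∀ c : AddCon (Fin n →₀ ℕ), (∀ p ∈ F, c p.1 p.2) → ∀ u v : Fin n →₀ ℕ,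
      u.support ⊆ S → v.support ⊆ S → Finsupp.weight w u = Finsupp.weight w v → c u v

theorem hasFewRelations_empty {n : ℕ} (w : Fin n → ℕ) : HasFewRelations ∅ w := by
  refine ⟨∅, by simp, by simp, fun c _ u v hu hv _ => ?_⟩
  rw [Finset.subset_empty, Finsupp.support_eq_empty] at hu hv
  rw [hu, hv]
  exact c.refl _

theorem hasFewRelations_singleton {n : ℕ} {w : Fin n → ℕ} {i : Fin n} (hi : 0 < w i) :
    HasFewRelations {i} w := by
  refine ⟨∅, by simp, by simp, fun c _ u v hu hv huv => ?_⟩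
  rw [weight_eq_sum_of_support_subset w hu, weight_eq_sum_of_support_subset w hv] at huv
  rw [Finsupp.support_subset_singleton] at hu hv
  have : u i = v i := by simpa [hi.ne'] using huv
  rw [hu, hv, this]
  exact c.refl _

/-- The additive endomorphism that multiplies the exponent of `xᵢ` by `B`. -/
noncomputable def scaleCoord {n : ℕ} (i : Fin n) (B : ℕ) : (Fin n →₀ ℕ) →+ (Fin n →₀ ℕ) where
  toFun u := Finsupp.equivFunOnFinite.symm fun l => (if l = i then B else 1) * u l
  map_zero' := by ext; simp
  map_add' u v := by ext; simp [mul_add]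

theorem scaleCoord_apply {n : ℕ} (i : Fin n) (B : ℕ) (u : Fin n →₀ ℕ) (l : Fin n) :
    scaleCoord i B u l = (if l = i then B else 1) * u l := rfl

theorem weight_scaleCoord {n : ℕ} (w : Fin n → ℕ) (i : Fin n) (B : ℕ) (u : Fin n →₀ ℕ) :
    Finsupp.weight w (scaleCoord i B u) =
      Finsupp.weight (Function.update w i (B * w i)) u := by
  rw [Finsupp.weight_eq_sum, Finsupp.weight_eq_sum]
  refine Finset.sum_congr rfl fun l _ => ?_
  rw [scaleCoord_apply]
  by_cases h : l = i
  · subst h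
    simp only [if_true, Function.update_self, smul_eq_mul]
    ring
  · simp [h]

theorem HasFewRelations.insert_of_mem {n : ℕ} {S : Finset (Fin n)} {w : Fin n → ℕ} {i : Fin n}
    (hi : i ∈ S) (h : HasFewRelations (S.erase i) w) (hne : (S.erase i).Nonempty)
    (hmem : w i ∈ CIReduction.natSpan ((S.erase i).val.map w)) : HasFewRelations S w := by
  classical
  obtain ⟨M, hM, hMw⟩ := (mem_natSpan_map_iff w _ _).1 hmem
  obtain ⟨F, hF, hFw, hFc⟩ := h
  refine ⟨insert (Finsupp.single i 1, M) F, ?_, ?_, fun c hc => ?_⟩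
  -- Nonemptiness of `S.erase i` is needed here: with truncated subtraction, both bounds would be 0
  -- for a singleton `S`, leaving no room for the new pair.
  · have := Finset.card_insert_le (Finsupp.single i 1, M) F
    have h1 := Finset.card_erase_of_mem hi
    have h2 := hne.card_pos
    omega
  · intro p hp
    rcases Finset.mem_insert.1 hp with rfl | hp
    · simp [Finsupp.weight_single, hMw]
    · exact hFw p hp
  · have hiM : c (Finsupp.single i 1) M := hc _ (Finset.mem_insert_self _ _)
    have hred : ∀ u : Fin n →₀ ℕ, u.support ⊆ S → ∃ u', u'.support ⊆ S.erase i ∧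
        Finsupp.weight w u' = Finsupp.weight w u ∧ c u u' := by
      intro u hu
      have hdec : u = u i • Finsupp.single i 1 + u.erase i := by
        rw [Finsupp.smul_single, smul_eq_mul, mul_one, Finsupp.single_add_erase]
      refine ⟨u i • M + u.erase i, ?_, ?_, ?_⟩
      · refine Finsupp.support_add.trans (Finset.union_subset
          (Finsupp.support_smul.trans hM) ?_)
        rw [Finsupp.support_erase]
        exact Finset.erase_subset_erase _ hu
      · conv_rhs => rw [hdec]
        simp [hMw, Finsupp.weight_single]
      · conv_lhs => rw [hdec]
        exact c.add (c.nsmul _ hiM) (c.refl _)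
    intro u v hu hv huv
    obtain ⟨u', hu', hwu, hcu⟩ := hred u hu
    obtain ⟨v', hv', hwv, hcv⟩ := hred v hv
    refine c.trans hcu (c.trans ?_ (c.symm hcv))
    exact hFc c (fun p hp => hc p (Finset.mem_insert_of_mem hp)) u' v' hu' hv'
      (by rw [hwu, hwv, huv])

-- The relations for the scaled weight are transported by `scaleCoord`, that is, by substituting `xᵢ
-- ^ B` for `xᵢ`. They suffice because the exponents of `xᵢ` in two monomials of equal weight are
-- congruent mod `B`.
open CIReduction in
theorem HasFewRelations.of_scale {n : ℕ} {S : Finset (Fin n)} {w : Fin n → ℕ} {i : Fin n}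
    (hi : i ∈ S) (hrat : (w i : ℚ) ∈ ratSpan ((S.erase i).val.map w))
    (h : HasFewRelations S
      (Function.update w i (index (w i) ((S.erase i).val.map w) * w i))) :
    HasFewRelations S w := by
  classical
  set t := (S.erase i).val.map w with ht
  set B := index (w i) t with hB
  obtain ⟨hBpos, -⟩ := index_spec hrat
  obtain ⟨F, hF, hFw, hFc⟩ := h
  refine ⟨F.image fun p => (scaleCoord i B p.1, scaleCoord i B p.2),
    Finset.card_image_le.trans hF, ?_, fun c hc u v hu hv huv => ?_⟩
  · intro p hp
    obtain ⟨q, hq, rfl⟩ := Finset.mem_image.1 hp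
    simpa only [weight_scaleCoord] using hFw q hq
  have hdvd : ∀ u : Fin n →₀ ℕ, t.gcd ∣ ∑ l ∈ S.erase i, u l * w l := fun u =>
    Finset.dvd_sum fun l hl => (Multiset.gcd_dvd (Multiset.mem_map_of_mem w hl)).mul_left _
  -- The other weights contribute multiples of `t.gcd`, so `t.gcd` divides `(u i - v i) * w i`; this
  -- means that `B` divides `u i - v i`.
  have hmod : (u i) % B = (v i) % B := by
    have hsplit := huv
    rw [weight_eq_sum_of_support_subset w hu, weight_eq_sum_of_support_subset w hv,
      ← Finset.add_sum_erase S _ hi, ← Finset.add_sum_erase S _ hi] at hsplit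
    have hZ : (t.gcd : ℤ) ∣ ((u i : ℤ) - v i) * w i := by
      have e : ((u i : ℤ) - v i) * w i =
          ((∑ l ∈ S.erase i, v l * w l : ℕ) : ℤ) - ((∑ l ∈ S.erase i, u l * w l : ℕ) : ℤ) := by
        have := congrArg (Nat.cast (R := ℤ)) hsplit
        rw [Nat.cast_add, Nat.cast_add, Nat.cast_mul, Nat.cast_mul] at this
        linarith
      rw [e]
      exact dvd_sub (Int.natCast_dvd_natCast.2 (hdvd v)) (Int.natCast_dvd_natCast.2 (hdvd u))
    rw [index_spec_int hrat] at hZ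
    exact ((Nat.modEq_iff_dvd.2 hZ).symm)
  have hdec : ∀ u : Fin n →₀ ℕ, u.support ⊆ S → ∃ u' : Fin n →₀ ℕ, u'.support ⊆ S ∧
      u = Finsupp.single i (u i % B) + scaleCoord i B u' := by
    intro u hu
    refine ⟨u.update i (u i / B), ?_, ?_⟩
    · intro l hl
      by_cases h : l = i
      · exact h ▸ hi
      · refine hu (Finsupp.mem_support_iff.2 ?_)
        simpa [h] using hl
    · ext l
      rw [Finsupp.add_apply, scaleCoord_apply]
      by_cases h : l = i
      · subst h
        simp [Nat.mod_add_div]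
      · simp [h]
  obtain ⟨u', hu', hue⟩ := hdec u hu
  obtain ⟨v', hv', hve⟩ := hdec v hv
  rw [hmod] at hue
  generalize v i % B = r at hue hve
  -- Once the common factor `xᵢ ^ r` is split off, the hypothesis applies to `c` pulled back along
  -- the substitution.
  have hc' : (c.comap (scaleCoord i B)
      (map_add (scaleCoord i B))) u' v' := by
    refine hFc _ (fun p hp => ?_) u' v' hu' hv' ?_
    · exact hc _ (Finset.mem_image_of_mem _ hp)
    · rw [hue, hve, map_add, map_add, add_right_inj, weight_scaleCoord, weight_scaleCoord] at huv
      exact huv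
  rw [hue, hve]
  exact c.add (c.refl _) hc'

open CIReduction in
theorem hasFewRelations_of_reflTransGen {n : ℕ} {s : Multiset ℕ}
    (hs : Relation.ReflTransGen Step s ∅) : ∀ (S : Finset (Fin n)) (w : Fin n → ℕ),
    (∀ i ∈ S, 0 < w i) → S.val.map w = s → HasFewRelations S w := by
  classical
  induction hs using Relation.ReflTransGen.head_induction_on with
  | refl =>
    intro S w _ h
    have : S = ∅ := by simpa using h
    exact this ▸ hasFewRelations_empty w
  | head hstep _ ih =>
    intro S w hpos h
    obtain ⟨b, t, rfl, hu⟩ := step_iff.1 hstep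
    obtain ⟨i, hi, rfl, ht⟩ := (Multiset.map_eq_cons _ _ _ _).2 h
    rw [← Finset.erase_val] at ht
    have hi : i ∈ S := hi
    subst ht
    have hpos' : ∀ l ∈ S.erase i, 0 < w l := fun l hl => hpos l (Finset.mem_of_mem_erase hl)
    -- A single weight needs no relation, whichever step was taken. With another positive weight
    -- present, `removeIndep` is impossible.
    rcases (S.erase i).eq_empty_or_nonempty with he | hne
    · have : S = {i} := by rw [← Finset.insert_erase hi, he, insert_empty_eq]
      rw [this]
      exact hasFewRelations_singleton (hpos i hi)
    rcases hu with ⟨rfl, h1⟩ | ⟨rfl, h1⟩ | ⟨rfl, h1, -⟩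
    · exfalso
      rw [mem_ratSpan] at h1
      push Not at h1
      obtain ⟨l, hl⟩ := hne
      have := (Multiset.gcd_eq_zero_iff _).1 h1.2 (w l) (Multiset.mem_map_of_mem w hl)
      exact (hpos' l hl).ne' this
    · exact (ih (S.erase i) w hpos' rfl).insert_of_mem hi hne h1
    · refine HasFewRelations.of_scale hi h1 (ih S _ (fun l hl => ?_) ?_)
      · by_cases hli : l = i
        · subst hli
          rw [Function.update_self]
          exact Nat.mul_pos (index_spec h1).1 (hpos l hi)
        · rw [Function.update_of_ne hli]
          exact hpos l hl
      · have hS : S.val = i ::ₘ (S.erase i).val := by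
          rw [Finset.erase_val, Multiset.cons_erase hi]
        rw [hS, Multiset.map_cons, Function.update_self]
        congr 1
        refine Multiset.map_congr rfl fun l hl => ?_
        rw [Function.update_of_ne (Finset.ne_of_mem_erase (Finset.mem_def.2 hl))]

/-- The congruence on monomials given by an ideal of the polynomial ring. -/
noncomputable def monomialCon {k : Type*} [Field k] {n : ℕ} (J : Ideal (MvPolynomial (Fin n) k)) :
    AddCon (Fin n →₀ ℕ) where
  r u v := (MvPolynomial.monomial u 1 - MvPolynomial.monomial v 1 : MvPolynomial (Fin n) k) ∈ J
  iseqv :=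
    { refl := fun u => by simp
      symm := fun h => by simpa using J.neg_mem h
      trans := fun h1 h2 => by simpa using J.add_mem h1 h2 }
  add' := fun {a b c d} h1 h2 => by
    have e : (MvPolynomial.monomial (a + c) 1 - MvPolynomial.monomial (b + d) 1 :
        MvPolynomial (Fin n) k) = MvPolynomial.monomial c 1 *
          (MvPolynomial.monomial a 1 - MvPolynomial.monomial b 1) +
        MvPolynomial.monomial b 1 *
          (MvPolynomial.monomial c 1 - MvPolynomial.monomial d 1) := by
      simp only [mul_sub, MvPolynomial.monomial_mul, one_mul]
      rw [add_comm a c, add_comm b c]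
      ring
    rw [e]
    exact J.add_mem (J.mul_mem_left _ h1) (J.mul_mem_left _ h2)

-- Congruence of monomials modulo the ideal spanned by the chosen binomials is an additive
-- congruence, so it identifies all monomials of equal weight. The count bounds the rank above by
-- the height; Krull's theorem gives the other inequality.
open MvPolynomial in
theorem isCompleteIntersection_of_hasFewRelations (k : Type*) [Field k] {n : ℕ}
    (d : Fin (n + 1) → ℕ) (hpos : ∀ i, 0 < d i) (h : HasFewRelations Finset.univ d) :
    IsCompleteIntersection (toricIdeal k d) := by
  classical
  obtain ⟨F, hF, hFw, hFc⟩ := h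
  have hspan : toricIdeal k d = Ideal.span
      (F.image fun p => (monomial p.1 1 - monomial p.2 1 : MvPolynomial (Fin (n + 1)) k)) := by
    refine le_antisymm (toricIdeal_le_of_binomial_mem k d _ fun u v huv => ?_) ?_
    · refine hFc (monomialCon _) (fun p hp => Ideal.subset_span ?_) u v (by simp) (by simp) huv
      exact Finset.mem_coe.2 (Finset.mem_image_of_mem _ hp)
    · rw [Ideal.span_le]
      intro x hx
      obtain ⟨p, hp, rfl⟩ := Finset.mem_image.1 (Finset.mem_coe.1 hx)
      exact binomial_mem_toricIdeal k (hFw p hp)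
  refine ⟨⟨_, hspan.symm⟩, le_antisymm ?_ ?_⟩
  · rw [height_toricIdeal k d hpos, hspan]
    refine (Submodule.spanFinrank_span_le_encard _).trans ?_
    rw [Set.encard_coe_eq_coe_finsetCard]
    refine Nat.cast_le.2 (Finset.card_image_le.trans (hF.trans ?_))
    simp
  · exact Ideal.height_le_spanFinrank _ (Ideal.IsPrime.ne_top inferInstance)

/-! ### Critical degrees and the coefficients they control -/

theorem mem_closure_image_ne_iff {n : ℕ} (d : Fin n → ℕ) (i : Fin n) (x : ℕ) :
    x ∈ AddSubmonoid.closure (d '' {j | j ≠ i}) ↔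
      ∃ u : Fin n →₀ ℕ, u i = 0 ∧ Finsupp.weight d u = x := by
  classical
  have h1 : d '' {j | j ≠ i} = {x | x ∈ (Finset.univ.erase i).val.map d} := by
    ext y
    simp only [Set.mem_image, Set.mem_ofPred_eq, Multiset.mem_map, Finset.mem_val,
      Finset.mem_erase, Finset.mem_univ, and_true]
  rw [h1]
  change x ∈ CIReduction.natSpan _ ↔ _
  rw [mem_natSpan_map_iff]
  refine exists_congr fun u => and_congr_left fun _ => ?_
  rw [Finset.subset_erase]
  simp

theorem critMult_spec {n : ℕ} (hn : 2 ≤ n) {d : Fin n → ℕ} (hpos : ∀ i, 0 < d i) (i : Fin n) :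
    0 < critMult d i ∧ ∃ u : Fin n →₀ ℕ, u i = 0 ∧ Finsupp.weight d u = critMult d i * d i := by
  have hmem : critMult d i ∈
      {b : ℕ | 0 < b ∧ b * d i ∈ AddSubmonoid.closure (d '' {j | j ≠ i})} := by
    refine Nat.sInf_mem ?_
    have : Nontrivial (Fin n) := Fin.nontrivial_iff_two_le.2 hn
    obtain ⟨j, hj⟩ := exists_ne i
    refine ⟨d j, hpos j, ?_⟩
    rw [mul_comm, ← smul_eq_mul]
    exact nsmul_mem (AddSubmonoid.subset_closure (Set.mem_image_of_mem d hj)) _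
  exact ⟨hmem.1, (mem_closure_image_ne_iff d i _).1 hmem.2⟩

/-- Below the critical degree, the powers of `xᵢ` are alone in their degree. -/
theorem eq_single_of_lt_critMult {n : ℕ} {d : Fin n → ℕ} (hpos : ∀ i, 0 < d i) {i : Fin n}
    {b : ℕ} (hb : b < critMult d i) {u : Fin n →₀ ℕ} (hu : Finsupp.weight d u = b * d i) :
    u = Finsupp.single i b := by
  have hdec := Finsupp.single_add_erase i u
  have hw : u i * d i + Finsupp.weight d (u.erase i) = b * d i := by
    rw [← hu]
    conv_rhs => rw [← hdec]
    rw [map_add, Finsupp.weight_single, smul_eq_mul]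
  have hle : u i ≤ b := Nat.le_of_mul_le_mul_right (by omega) (hpos i)
  have hw' : Finsupp.weight d (u.erase i) = (b - u i) * d i := by
    rw [Nat.sub_mul]; omega
  -- Cancelling `xᵢ ^ (u i)` writes `(b - u i) * d i` in the other weights, against the minimality
  -- of `critMult d i` unless the factor is 0.
  have hz : b - u i = 0 := by
    by_contra hne
    have : critMult d i ≤ b - u i := Nat.sInf_le ⟨Nat.pos_of_ne_zero hne,
      (mem_closure_image_ne_iff d i _).2 ⟨u.erase i, by simp, hw'⟩⟩
    omega
  rw [hz, zero_mul, weight_eq_zero_iff_of_pos hpos] at hw'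
  rw [← hdec, hw', add_zero, show u i = b by omega]

-- The coefficient of `t ^ D` in the image of `g` is the sum of the coefficients of `g` in weight
-- `D`; here that sum has only one possible term.
open MvPolynomial in
theorem coeff_eq_zero_of_mem_toricIdeal {k : Type*} [Field k] {n : ℕ} {d : Fin n → ℕ}
    {g : MvPolynomial (Fin n) k} (hg : g ∈ toricIdeal k d) {v : Fin n →₀ ℕ}
    (hv : ∀ u, Finsupp.weight d u = Finsupp.weight d v → u = v) : coeff v g = 0 := by
  classical
  have hg' : aeval (R := k) (fun i => (Polynomial.X : Polynomial k) ^ d i) g = 0 := hg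
  rw [← support_sum_monomial_coeff g, map_sum] at hg'
  simp only [aeval_pow_monomial] at hg'
  have h := congrArg (fun p => Polynomial.coeff p (Finsupp.weight d v)) hg'
  simp only [Polynomial.finsetSum_coeff, Polynomial.coeff_monomial, Polynomial.coeff_zero] at h
  rw [Finset.sum_eq_single v (fun u _ hne => if_neg fun he => hne (hv u he))
    (fun hv => by simpa using hv)] at h
  simpa using h

open MvPolynomial in
theorem ker_constantCoeff_mul_induction {k : Type*} [Field k] {n : ℕ}
    {I : Ideal (MvPolynomial (Fin n) k)} {P : MvPolynomial (Fin n) k → Prop}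
    (hX : ∀ j, ∀ g ∈ I, P (X j * g)) (h0 : P 0) (hadd : ∀ p q, P p → P q → P (p + q))
    {p : MvPolynomial (Fin n) k}
    (hp : p ∈ RingHom.ker (constantCoeff : MvPolynomial (Fin n) k →+* k) * I) : P p := by
  refine Submodule.mul_induction_on hp (fun r hr g hg => ?_) hadd
  rw [ker_constantCoeff_eq_span] at hr
  refine Submodule.span_induction (p := fun r _ => ∀ g ∈ I, P (r * g)) ?_ ?_ ?_ ?_ hr g hg
  · rintro _ ⟨j, rfl⟩
    exact hX j
  · intro g _
    rwa [zero_mul]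
  · intro x y _ _ hx hy g hg
    rw [add_mul]
    exact hadd _ _ (hx g hg) (hy g hg)
  · intro a x _ hx g hg
    rw [smul_eq_mul, mul_comm a x, mul_assoc]
    exact hx _ (I.mul_mem_left _ hg)

-- In `X j * g` the monomial `xᵢ ^ mᵢ` can arise only for `j = i`, from `xᵢ ^ (mᵢ - 1)` in `g`. That
-- monomial is alone in its degree, so its coefficient in an element of the toric ideal is 0.
open MvPolynomial in
theorem coeff_critMult_eq_zero {k : Type*} [Field k] {n : ℕ} {d : Fin n → ℕ}
    (hpos : ∀ i, 0 < d i) (i : Fin n) {p : MvPolynomial (Fin n) k}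
    (hm : 0 < critMult d i)
    (hp : p ∈ RingHom.ker (constantCoeff : MvPolynomial (Fin n) k →+* k) * toricIdeal k d) :
    coeff (Finsupp.single i (critMult d i)) p = 0 := by
  classical
  refine ker_constantCoeff_mul_induction
    (P := fun p => coeff (Finsupp.single i (critMult d i)) p = 0) ?_ (by simp)
    (fun p q hp hq => by rw [coeff_add, hp, hq, add_zero]) hp
  intro j g hg
  rw [coeff_X_mul']
  split_ifs with h
  · have hj : j = i := by
      by_contra hne
      simp [Ne.symm hne] at h
    subst hj
    rw [← Finsupp.single_tsub]
    refine coeff_eq_zero_of_mem_toricIdeal hg fun u hu => ?_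
    refine eq_single_of_lt_critMult hpos (by omega) ?_
    rw [hu, Finsupp.weight_single, smul_eq_mul]
  · rfl

/-! ### Graded Nakayama and generation by critical binomials -/

open MvPolynomial in
theorem weightedHomogeneousComponent_monomial_mul {k : Type*} [Field k] {n : ℕ} (d : Fin n → ℕ)
    (D : ℕ) (s : Fin n →₀ ℕ) (r : k) (q : MvPolynomial (Fin n) k) :
    weightedHomogeneousComponent d D (monomial s r * q) =
      if Finsupp.weight d s ≤ D then
        monomial s r * weightedHomogeneousComponent d (D - Finsupp.weight d s) q else 0 := by
  classical
  ext u
  rw [coeff_weightedHomogeneousComponent, coeff_monomial_mul']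
  by_cases hs : s ≤ u
  · obtain ⟨v, rfl⟩ := exists_add_of_le hs
    split_ifs with h1 h2 h2
    · rw [coeff_monomial_mul, coeff_weightedHomogeneousComponent, if_pos, add_tsub_cancel_left]
      rw [← h1, map_add, add_tsub_cancel_left]
    · rw [← h1, map_add] at h2
      omega
    · rw [coeff_monomial_mul, coeff_weightedHomogeneousComponent, if_neg, mul_zero]
      rw [map_add] at h1
      omega
    · simp
  · rw [if_neg hs, ite_self]
    split_ifs
    · rw [coeff_monomial_mul', if_neg hs]
    · simp

open MvPolynomial in
/-- A graded version of Nakayama's lemma. -/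
theorem le_span_of_le_sup_ker_mul {k : Type*} [Field k] {n : ℕ} {d : Fin n → ℕ}
    (hpos : ∀ i, 0 < d i) {I : Ideal (MvPolynomial (Fin n) k)} {T : Type*}
    (u v : T → (Fin n →₀ ℕ)) (huv : ∀ i, Finsupp.weight d (u i) = Finsupp.weight d (v i))
    (h : I ≤ Ideal.span (Set.range fun i => (monomial (u i) 1 - monomial (v i) 1)) ⊔
      RingHom.ker (constantCoeff : MvPolynomial (Fin n) k →+* k) * I) :
    I ≤ Ideal.span (Set.range fun i => (monomial (u i) 1 - monomial (v i) 1)) := by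
  set J : Ideal (MvPolynomial (Fin n) k) :=
    Ideal.span (Set.range fun i => (monomial (u i) 1 - monomial (v i) 1)) with hJ
  -- Both terms of each generator have the same weight, so `J` is homogeneous. The induction is run
  -- on all multiples `a * p` and then specialized to `a = 1`.
  have hhom : ∀ p ∈ J, ∀ D, weightedHomogeneousComponent d D p ∈ J := by
    intro p hp D
    refine Submodule.span_induction
      (p := fun p _ => ∀ a, weightedHomogeneousComponent d D (a * p) ∈ J) ?_ ?_ ?_ ?_ hp 1
      |> fun h => by simpa using h
    · rintro _ ⟨i, rfl⟩ a
      have hi : (monomial (u i) 1 - monomial (v i) 1 : MvPolynomial (Fin n) k) ∈ J :=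
        Ideal.subset_span ⟨i, rfl⟩
      rw [mul_comm, sub_mul, map_sub, weightedHomogeneousComponent_monomial_mul,
        weightedHomogeneousComponent_monomial_mul, huv]
      split_ifs
      · rw [← sub_mul]
        exact J.mul_mem_right _ hi
      · simp
    · simp
    · intro x y _ _ hx hy a
      rw [mul_add, map_add]
      exact J.add_mem (hx a) (hy a)
    · intro b x _ hx a
      rw [smul_eq_mul, ← mul_assoc]
      exact hx _
  -- Induction on degree works because multiplication by `X j` shifts it by `d j > 0`.
  have key : ∀ D, ∀ p ∈ I, weightedHomogeneousComponent d D p ∈ J := by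
    intro D
    induction D using Nat.strong_induction_on with
    | _ D ih =>
      intro p hp
      obtain ⟨s, hs, ν, hν, rfl⟩ := Submodule.mem_sup.1 (h hp)
      rw [map_add]
      refine J.add_mem (hhom s hs D) ?_
      refine ker_constantCoeff_mul_induction
        (P := fun p => weightedHomogeneousComponent d D p ∈ J) ?_ (by simp)
        (fun p q hp hq => by rw [map_add]; exact J.add_mem hp hq) hν
      intro j g hg
      rw [X, weightedHomogeneousComponent_monomial_mul]
      split_ifs with hle
      · refine J.mul_mem_left _ (ih _ ?_ g hg)
        have := hpos j
        rw [Finsupp.weight_single, one_smul] at hle ⊢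
        omega
      · simp
  intro p hp
  rw [← finsum_weightedHomogeneousComponent d p]
  exact finsum_induction (· ∈ J) J.zero_mem (fun _ _ => J.add_mem) fun D => key D p hp

-- The classes of the `g l` span I/𝔪I, and the dual functionals make those of the `f i` independent.
-- Both families are indexed by `T`, so the `f i` span as well.
open MvPolynomial in
theorem le_span_sup_ker_mul {k : Type*} [Field k] {n : ℕ} {I : Ideal (MvPolynomial (Fin n) k)}
    {T : Type*} [Fintype T] [DecidableEq T] {f g : T → MvPolynomial (Fin n) k}
    (hf : ∀ i, f i ∈ I) (hg : Ideal.span (Set.range g) = I)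
    (φ : T → MvPolynomial (Fin n) k →ₗ[k] k)
    (hφ : ∀ i, ∀ p ∈ RingHom.ker (constantCoeff : MvPolynomial (Fin n) k →+* k) * I, φ i p = 0)
    (hδ : ∀ i j, φ j (f i) = if i = j then 1 else 0) :
    I ≤ Ideal.span (Set.range f) ⊔
      RingHom.ker (constantCoeff : MvPolynomial (Fin n) k →+* k) * I := by
  set N := RingHom.ker (constantCoeff : MvPolynomial (Fin n) k →+* k) * I with hN
  have hgI : ∀ l, g l ∈ I := fun l => hg ▸ Ideal.subset_span ⟨l, rfl⟩
  have hex : ∀ i, ∃ c : T → MvPolynomial (Fin n) k, ∑ l, c l * g l = f i := fun i =>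
    Ideal.mem_span_range_iff_exists_fun.1 (hg.symm ▸ hf i)
  choose a ha using hex
  have hsub : ∀ p : MvPolynomial (Fin n) k, ∀ l, (p - C (constantCoeff p)) * g l ∈ N :=
    fun p l => Ideal.mul_mem_mul (by simp [RingHom.mem_ker]) (hgI l)
  have hφa : ∀ j (p : MvPolynomial (Fin n) k) l, φ j (p * g l) = constantCoeff p * φ j (g l) := by
    intro j p l
    have := hφ j _ (hsub p l)
    rw [sub_mul, map_sub, sub_eq_zero, C_mul', map_smul, smul_eq_mul] at this
    exact this
  let Q : Matrix T T k := fun i l => constantCoeff (a i l)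
  let P : Matrix T T k := fun l i => φ i (g l)
  have hQP : Q * P = 1 := by
    ext i j
    rw [Matrix.mul_apply, Matrix.one_apply, ← hδ i j, ← ha i, map_sum]
    exact Finset.sum_congr rfl fun l _ => (hφa j _ l).symm
  -- A one-sided inverse of a square matrix is two-sided; the equal sizes of the families enter
  -- here.
  have hPQ : P * Q = 1 := mul_eq_one_comm.1 hQP
  conv_lhs => rw [← hg]
  rw [Ideal.span_le]
  rintro _ ⟨l, rfl⟩
  have e1 : g l = ∑ i, ∑ l', C (P l i * Q i l') * g l' := by
    rw [Finset.sum_comm]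
    have : ∀ l', ∑ i, C (P l i * Q i l') * g l' =
        if l = l' then g l' else (0 : MvPolynomial (Fin n) k) := fun l' => by
      rw [← Finset.sum_mul, ← map_sum, ← Matrix.mul_apply, hPQ, Matrix.one_apply]
      split_ifs <;> simp
    simp only [this, Finset.sum_ite_eq, Finset.mem_univ, if_true]
  -- Replacing the constants `Q i l'` by the full coefficients `a i l'` turns the sum into a
  -- combination of the `f i`, with an error in 𝔪I.
  have e2 : g l = ∑ i, C (P l i) * f i -
      ∑ i, ∑ l', C (P l i) * ((a i l' - C (constantCoeff (a i l'))) * g l') := by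
    conv_lhs => rw [e1]
    rw [← Finset.sum_sub_distrib]
    refine Finset.sum_congr rfl fun i _ => ?_
    rw [← ha i, Finset.mul_sum, ← Finset.sum_sub_distrib]
    refine Finset.sum_congr rfl fun l' _ => ?_
    rw [C_mul]
    ring
  change g l ∈ _
  rw [e2]
  refine sub_mem (Ideal.mem_sup_left ?_) (Ideal.mem_sup_right ?_)
  · exact sum_mem fun i _ => Ideal.mul_mem_left _ _ (Ideal.subset_span ⟨i, rfl⟩)
  · exact sum_mem fun i _ => sum_mem fun l' _ => Ideal.mul_mem_left _ _ (hsub _ _)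

open MvPolynomial in
/-- If all but one of the critical degrees are distinct, then a complete intersection is generated
by critical binomials. -/
theorem toricIdeal_eq_span_critical (k : Type*) [Field k] {n : ℕ} (hn : 2 ≤ n + 1)
    {d : Fin (n + 1) → ℕ} (hpos : ∀ i, 0 < d i) {i₀ : Fin (n + 1)}
    (hdist : Set.InjOn (fun i => critMult d i * d i) {i | i ≠ i₀})
    {M : Fin (n + 1) → (Fin (n + 1) →₀ ℕ)} (hM : ∀ i, M i i = 0)
    (hMw : ∀ i, Finsupp.weight d (M i) = critMult d i * d i)
    (hCI : IsCompleteIntersection (toricIdeal k d)) :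
    toricIdeal k d = Ideal.span (Set.range fun i : {i // i ≠ i₀} =>
      (monomial (Finsupp.single i.1 (critMult d i)) 1 - monomial (M i) 1 :
        MvPolynomial (Fin (n + 1)) k)) := by
  classical
  obtain ⟨hfg, hrank⟩ := hCI
  rw [height_toricIdeal k d hpos, Nat.cast_inj] at hrank
  obtain ⟨s, hs, hspan⟩ := Submodule.FG.exists_span_finset_card_eq_spanFinrank hfg
  rw [hrank] at hs
  have hcard : Fintype.card {i : Fin (n + 1) // i ≠ i₀} = Fintype.card s := by
    rw [Fintype.card_coe, hs, Fintype.card_subtype_compl]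
    simp
  let e := Fintype.equivOfCardEq hcard
  have hg : Ideal.span (Set.range fun i => ((e i : s) : MvPolynomial (Fin (n + 1)) k)) =
      toricIdeal k d := by
    rw [← hspan]
    congr 1
    refine (e.surjective.range_comp fun x : s => (x : MvPolynomial (Fin (n + 1)) k)).trans ?_
    simp
  have hw : ∀ i, Finsupp.weight d (Finsupp.single i (critMult d i)) = critMult d i * d i :=
    fun i => by rw [Finsupp.weight_single, smul_eq_mul]
  have hf : ∀ i : {i // i ≠ i₀}, (monomial (Finsupp.single i.1 (critMult d i)) 1 -
      monomial (M i) 1 : MvPolynomial (Fin (n + 1)) k) ∈ toricIdeal k d := fun i =>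
    binomial_mem_toricIdeal k (by rw [hw, hMw])
  refine le_antisymm ?_ ?_
  · refine le_span_of_le_sup_ker_mul hpos _ _ (fun i => by rw [hw, hMw]) ?_
    refine le_span_sup_ker_mul hf hg
      (fun i => MvPolynomial.lcoeff k (Finsupp.single i.1 (critMult d i)))
      (fun i p hp => ?_) fun i j => ?_
    · exact coeff_critMult_eq_zero hpos i.1 (critMult_spec hn hpos i.1).1 hp
    · simp only [lcoeff_apply, coeff_sub, coeff_monomial]
      -- Equality would force `i = j` by comparing degrees, but `x ^ Mᵢ` does not involve `xᵢ`.
      have hne : M i ≠ Finsupp.single j.1 (critMult d j) := by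
        intro he
        have h1 := congrArg (Finsupp.weight d) he
        rw [hw, hMw] at h1
        have h2 : i.1 = j.1 := hdist i.2 j.2 h1
        have h3 := hM i.1
        rw [he, h2, Finsupp.single_eq_same] at h3
        exact (critMult_spec hn hpos j.1).1.ne' h3
      rw [if_neg hne, sub_zero]
      refine if_congr ⟨fun he => ?_, fun he => by rw [he]⟩ rfl rfl
      have h1 := congrArg (Finsupp.weight d) he
      rw [hw, hw] at h1
      exact Subtype.ext (hdist i.2 j.2 h1)
  · rw [Ideal.span_le]
    rintro _ ⟨i, rfl⟩
    exact hf i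

/-! ### Krull's theorem excludes cyclic dependence among the variables -/

open MvPolynomial in
/-- If the toric ideal is generated by binomials `xᵢ ^ mᵢ - x ^ Mᵢ` for `i ≠ i₀`, then every
nonempty set of variables that does not contain `i₀` has a member `i` such that `x ^ Mᵢ` involves
none of these variables. -/
theorem exists_forall_eq_zero_of_span_eq (k : Type*) [Field k] {n : ℕ} {d : Fin (n + 1) → ℕ}
    (hpos : ∀ i, 0 < d i) {i₀ : Fin (n + 1)} {m : Fin (n + 1) → ℕ} (hm : ∀ i, 0 < m i)
    {M : Fin (n + 1) → (Fin (n + 1) →₀ ℕ)}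
    (hspan : toricIdeal k d = Ideal.span (Set.range fun i : {i // i ≠ i₀} =>
      (monomial (Finsupp.single i.1 (m i)) 1 - monomial (M i) 1 : MvPolynomial (Fin (n + 1)) k)))
    {J : Finset (Fin (n + 1))} (hJ : J.Nonempty) (hi₀ : i₀ ∉ J) :
    ∃ i ∈ J, ∀ j ∈ J, M i j = 0 := by
  classical
  by_contra! hcon
  let f : Fin (n + 1) → MvPolynomial (Fin (n + 1)) k := fun i =>
    monomial (Finsupp.single i (m i)) 1 - monomial (M i) 1
  have hfI : ∀ i, i ≠ i₀ → f i ∈ toricIdeal k d := fun i hi => by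
    rw [hspan]
    exact Ideal.subset_span ⟨⟨i, hi⟩, rfl⟩
  -- Each `f i` with `i ∈ J` is traded for the variable `X i`, so there are still at most `n`
  -- elements. They cannot have the origin, of height `n + 1`, as a minimal prime.
  let s : Finset (MvPolynomial (Fin (n + 1)) k) := J.image X ∪ (insert i₀ J)ᶜ.image f
  have hcard : s.card ≤ n := by
    refine (Finset.card_union_le _ _).trans ?_
    have h1 := Finset.card_image_le (s := J) (f := (X : _ → MvPolynomial (Fin (n + 1)) k))
    have h2 := Finset.card_image_le (s := (insert i₀ J)ᶜ) (f := f)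
    rw [Finset.card_compl, Finset.card_insert_of_notMem hi₀, Fintype.card_fin] at h2
    have h3 := Finset.card_le_univ (insert i₀ J)
    rw [Finset.card_insert_of_notMem hi₀, Fintype.card_fin] at h3
    omega
  have hmin : RingHom.ker (constantCoeff : MvPolynomial (Fin (n + 1)) k →+* k) ∈
      (Ideal.span (s : Set (MvPolynomial (Fin (n + 1)) k))).minimalPrimes := by
    refine ⟨⟨RingHom.ker_isPrime _, ?_⟩, fun p hp _ => ?_⟩
    · rw [Ideal.span_le]
      intro x hx
      rcases Finset.mem_union.1 (Finset.mem_coe.1 hx) with hx | hx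
      · obtain ⟨j, _, rfl⟩ := Finset.mem_image.1 hx
        exact X_mem_ker_constantCoeff k j
      · obtain ⟨i, hi, rfl⟩ := Finset.mem_image.1 hx
        refine toricIdeal_le_ker_constantCoeff k hpos (hfI i ?_)
        rintro rfl
        simp at hi
    · obtain ⟨hpp, hps⟩ := hp
      have hXp : ∀ j ∈ J, X j ∈ p := fun j hj =>
        hps (Ideal.subset_span (Finset.mem_coe.2
          (Finset.mem_union_left _ (Finset.mem_image_of_mem _ hj))))
      have hmonp : ∀ (u : Fin (n + 1) →₀ ℕ), ∀ j ∈ J, u j ≠ 0 →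
          (monomial u 1 : MvPolynomial (Fin (n + 1)) k) ∈ p := by
        intro u j hj hu
        have hle : Finsupp.single j 1 ≤ u := by
          rw [Finsupp.single_le_iff]
          omega
        obtain ⟨v, rfl⟩ := exists_add_of_le hle
        have := p.mul_mem_right (monomial v 1) (hXp j hj)
        rwa [X, monomial_mul, one_mul] at this
      -- For `i ∈ J`, both terms of `f i` are divisible by variables from `J`; the remaining
      -- generators belong to `s`.
      have hIp : toricIdeal k d ≤ p := by
        rw [hspan, Ideal.span_le]
        rintro _ ⟨⟨i, hi⟩, rfl⟩
        by_cases hiJ : i ∈ J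
        · obtain ⟨j, hj, hne⟩ := hcon i hiJ
          exact p.sub_mem (hmonp _ i hiJ (by simpa using (hm i).ne')) (hmonp _ j hj hne)
        · refine hps (Ideal.subset_span (Finset.mem_coe.2 (Finset.mem_union_right _
            (Finset.mem_image_of_mem f ?_))))
          simp [hi, hiJ]
      obtain ⟨j, hj⟩ := hJ
      exact ker_constantCoeff_le_of_toricIdeal_le k hpos hpp hIp (hXp j hj)
  have h := (le_height_ker_constantCoeff k n).trans
    (Ideal.height_le_card_of_mem_minimalPrimes_span_finset hmin)
  have := Nat.cast_le.1 h
  omega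

/-! ### The lattice of relations and the reduction to ∅ -/

-- The ring map to the group algebra of `G` induced by `q` kills the generators, and distinct group
-- elements are distinct basis vectors there.
open MvPolynomial in
theorem map_eq_of_sub_mem_span_binomials (k : Type*) [Field k] {n : ℕ} {T G : Type*}
    [AddCommGroup G] (q : (Fin n →₀ ℕ) →+ G) {a b : T → (Fin n →₀ ℕ)}
    (hab : ∀ i, q (a i) = q (b i)) {u v : Fin n →₀ ℕ}
    (h : (monomial u 1 - monomial v 1 : MvPolynomial (Fin n) k) ∈
      Ideal.span (Set.range fun i => (monomial (a i) 1 - monomial (b i) 1))) : q u = q v := by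
  let φ : MvPolynomial (Fin n) k →+* AddMonoidAlgebra k G := AddMonoidAlgebra.mapDomainRingHom k q
  have hφ : ∀ u, φ (monomial u 1) = AddMonoidAlgebra.single (q u) 1 := fun u =>
    AddMonoidAlgebra.mapDomain_single
  have hle : Ideal.span (Set.range fun i => (monomial (a i) 1 - monomial (b i) 1)) ≤
      RingHom.ker φ := by
    rw [Ideal.span_le]
    rintro _ ⟨i, rfl⟩
    change φ _ = 0
    rw [map_sub, hφ, hφ, hab, sub_self]
  have h1 : φ _ = 0 := hle h
  rw [map_sub, hφ, hφ, sub_eq_zero] at h1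
  exact (AddMonoidAlgebra.single_left_inj one_ne_zero).1 h1

/-- The exponent vectors of the binomials `xₓ ^ mₓ - x ^ Mₓ` with `x ∈ S`, `x ≠ i₀`, span the
lattice of relations between the weights in `S`. -/
def SpansRelations {n : ℕ} (d : Fin n → ℕ) (i₀ : Fin n) (m : Fin n → ℕ) (M : Fin n → (Fin n →₀ ℕ))
    (S : Finset (Fin n)) : Prop :=
  ∀ u v : Fin n →₀ ℕ, u.support ⊆ S → v.support ⊆ S → Finsupp.weight d u = Finsupp.weight d v →
    ∃ c : Fin n → ℤ, ∀ l, (u l : ℤ) - v l =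
      ∑ x ∈ S.erase i₀, c x * ((Finsupp.single x (m x) l : ℤ) - M x l)

-- Grade the monomials by ℤⁿ modulo the lattice `L` of the generators' exponent vectors. A binomial
-- in the ideal has both terms in the same class.
open MvPolynomial in
theorem spansRelations_univ (k : Type*) [Field k] {n : ℕ} {d : Fin n → ℕ} {i₀ : Fin n}
    {m : Fin n → ℕ} {M : Fin n → (Fin n →₀ ℕ)}
    (hspan : toricIdeal k d = Ideal.span (Set.range fun i : {i // i ≠ i₀} =>
      (monomial (Finsupp.single i.1 (m i)) 1 - monomial (M i) 1 : MvPolynomial (Fin n) k))) :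
    SpansRelations d i₀ m M Finset.univ := by
  classical
  intro u v _ _ huv
  let ι : (Fin n →₀ ℕ) →+ (Fin n → ℤ) :=
    { toFun := fun u l => (u l : ℤ)
      map_zero' := by ext; simp
      map_add' := fun u v => by ext; simp }
  let L : Submodule ℤ (Fin n → ℤ) := Submodule.span ℤ
    (Set.range fun i : {i // i ≠ i₀} => ι (Finsupp.single i.1 (m i)) - ι (M i))
  let q : (Fin n →₀ ℕ) →+ (Fin n → ℤ) ⧸ L := L.mkQ.toAddMonoidHom.comp ι
  have hq : ∀ u v, q u = q v ↔ ι u - ι v ∈ L := fun u v => Submodule.Quotient.eq L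
  have h := map_eq_of_sub_mem_span_binomials k q
    (a := fun i : {i // i ≠ i₀} => Finsupp.single i.1 (m i)) (b := fun i => M i)
    (fun i => (hq _ _).2 (Submodule.subset_span ⟨i, rfl⟩))
    (hspan ▸ binomial_mem_toricIdeal k huv)
  rw [hq, Submodule.mem_span_range_iff_exists_fun] at h
  obtain ⟨c, hc⟩ := h
  refine ⟨fun x => if hx : x ≠ i₀ then c ⟨x, hx⟩ else 0, fun l => ?_⟩
  have hl := congrFun hc l
  rw [Finset.sum_apply] at hl
  change _ = (u l : ℤ) - v l at hl
  rw [← hl, ← Finset.sum_subtype_of_mem (p := fun i => i ≠ i₀)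
    (f := fun x => (if hx : x ≠ i₀ then c ⟨x, hx⟩ else 0) *
      ((Finsupp.single x (m x) l : ℤ) - M x l)) (fun x hx => Finset.ne_of_mem_erase hx)]
  have hs : Finset.subtype (fun i => i ≠ i₀) (Finset.univ.erase i₀) = Finset.univ := by
    ext x
    simp [x.2]
  rw [hs]
  refine Finset.sum_congr rfl fun x _ => ?_
  rw [dif_pos x.2]
  rfl

/-- Only the vector of the last variable `i` has a nonzero `i`-th coordinate, namely `m i`. So the
`i`-th coordinate of a relation is `c i * m i`, and `c i = 0` when the relation avoids `i`. -/
theorem SpansRelations.peel {n : ℕ} {d : Fin n → ℕ} {i₀ : Fin n} {m : Fin n → ℕ}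
    {M : Fin n → (Fin n →₀ ℕ)} {S : Finset (Fin n)} {i : Fin n} (hi : i ∉ S) (hne : i ≠ i₀)
    (hm : 0 < m i) (hMi : M i i = 0) (hMS : ∀ x ∈ S.erase i₀, M x i = 0)
    (h : SpansRelations d i₀ m M (insert i S)) :
    SpansRelations d i₀ m M S ∧ ∀ u v : Fin n →₀ ℕ, u.support ⊆ insert i S →
      v.support ⊆ insert i S → Finsupp.weight d u = Finsupp.weight d v →
      (m i : ℤ) ∣ (u i : ℤ) - v i := by
  classical
  have herase : (insert i S).erase i₀ = insert i (S.erase i₀) :=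
    Finset.erase_insert_of_ne hne
  have hi' : i ∉ S.erase i₀ := fun h => hi (Finset.mem_of_mem_erase h)
  have hcol : ∀ c : Fin n → ℤ, ∑ x ∈ (insert i S).erase i₀,
      c x * ((Finsupp.single x (m x) i : ℤ) - M x i) = c i * m i := by
    intro c
    rw [herase, Finset.sum_insert hi', Finset.sum_eq_zero, hMi]
    · simp
    · intro x hx
      have : x ≠ i := fun he => hi' (he ▸ hx)
      rw [hMS x hx, Finsupp.single_eq_of_ne this.symm]
      simp
  refine ⟨fun u v hu hv huv => ?_, fun u v hu hv huv => ?_⟩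
  · obtain ⟨c, hc⟩ := h u v (hu.trans (Finset.subset_insert _ _))
      (hv.trans (Finset.subset_insert _ _)) huv
    have hui : u i = 0 := Finsupp.notMem_support_iff.1 fun h => hi (hu h)
    have hvi : v i = 0 := Finsupp.notMem_support_iff.1 fun h => hi (hv h)
    have hci := hc i
    rw [hcol, hui, hvi] at hci
    have hci0 : c i = 0 := by
      rcases mul_eq_zero.1 (by simpa using hci.symm : c i * (m i : ℤ) = 0) with h | h
      · exact h
      · omega
    refine ⟨c, fun l => ?_⟩
    rw [hc l, herase, Finset.sum_insert hi', hci0, zero_mul, zero_add]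
  · obtain ⟨c, hc⟩ := h u v hu hv huv
    rw [hc i, hcol]
    exact Dvd.intro_left _ rfl

/-- The variables of `S` can be listed, starting with `i₀`, in such a way that each monomial
`x ^ Mᵢ` involves only variables that precede `xᵢ`. -/
inductive IsTriangular {n : ℕ} (i₀ : Fin n) (M : Fin n → (Fin n →₀ ℕ)) : Finset (Fin n) → Prop
  | singleton : IsTriangular i₀ M {i₀}
  | insert (S : Finset (Fin n)) (i : Fin n) : i ∉ S → (M i).support ⊆ S → IsTriangular i₀ M S →
      IsTriangular i₀ M (insert i S)

theorem IsTriangular.mem {n : ℕ} {i₀ : Fin n} {M : Fin n → (Fin n →₀ ℕ)} {S : Finset (Fin n)}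
    (h : IsTriangular i₀ M S) : i₀ ∈ S := by
  induction h with
  | singleton => simp
  | insert S i _ _ _ ih => exact Finset.mem_insert_of_mem ih

theorem IsTriangular.support_subset {n : ℕ} {i₀ : Fin n} {M : Fin n → (Fin n →₀ ℕ)}
    {S : Finset (Fin n)} (h : IsTriangular i₀ M S) : ∀ x ∈ S.erase i₀, (M x).support ⊆ S := by
  induction h with
  | singleton => simp
  | insert S i hi hM hS ih =>
    intro x hx
    obtain ⟨hx0, hx⟩ := Finset.mem_erase.1 hx
    rcases Finset.mem_insert.1 hx with rfl | hx
    · exact hM.trans (Finset.subset_insert _ _)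
    · exact (ih x (Finset.mem_erase.2 ⟨hx0, hx⟩)).trans (Finset.subset_insert _ _)

open CIReduction in
theorem exists_weight_sub_of_mem_intSpan {n : ℕ} (d : Fin n → ℕ) (S : Finset (Fin n)) {z : ℤ}
    (hz : z ∈ intSpan (S.val.map d)) : ∃ u v : Fin n →₀ ℕ, u.support ⊆ S ∧ v.support ⊆ S ∧
      z = (Finsupp.weight d u : ℤ) - (Finsupp.weight d v : ℤ) := by
  classical
  refine AddSubgroup.closure_induction (p := fun z _ => ∃ u v : Fin n →₀ ℕ, u.support ⊆ S ∧
    v.support ⊆ S ∧ z = (Finsupp.weight d u : ℤ) - (Finsupp.weight d v : ℤ)) ?_ ?_ ?_ ?_ hz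
  · rintro _ ⟨y, hy, rfl⟩
    obtain ⟨i, hi, rfl⟩ := Multiset.mem_map.1 hy
    refine ⟨Finsupp.single i 1, 0, Finsupp.support_single_subset.trans (by simpa using hi),
      by simp, ?_⟩
    simp [Finsupp.weight_single]
  · exact ⟨0, 0, by simp, by simp, by simp⟩
  · rintro x y _ _ ⟨u, v, hu, hv, rfl⟩ ⟨u', v', hu', hv', rfl⟩
    refine ⟨u + u', v + v', Finsupp.support_add.trans (Finset.union_subset hu hu'),
      Finsupp.support_add.trans (Finset.union_subset hv hv'), ?_⟩
    rw [map_add, map_add]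
    push_cast
    ring
  · rintro x _ ⟨u, v, hu, hv, rfl⟩
    exact ⟨v, u, hv, hu, by ring⟩

open CIReduction in
theorem IsTriangular.reflTransGen {n : ℕ} {d : Fin n → ℕ} (hpos : ∀ i, 0 < d i) {i₀ : Fin n}
    {m : Fin n → ℕ} (hm : ∀ i, 0 < m i) {M : Fin n → (Fin n →₀ ℕ)} (hM : ∀ i, M i i = 0)
    (hMw : ∀ i, Finsupp.weight d (M i) = m i * d i) {S : Finset (Fin n)}
    (hS : IsTriangular i₀ M S) (hspan : SpansRelations d i₀ m M S) :
    Relation.ReflTransGen Step (S.val.map d) ∅ := by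
  classical
  induction hS with
  | singleton =>
    refine .single (.removeIndep (d i₀) 0 ?_)
    rw [mem_ratSpan]
    simpa using (hpos i₀).ne'
  | insert S i hi hMi hS ih =>
    have hne : i ≠ i₀ := fun he => hi (he ▸ hS.mem)
    obtain ⟨hspanS, hdvd⟩ := hspan.peel hi hne (hm i) (hM i) fun x hx =>
      Finsupp.notMem_support_iff.1 fun h => hi (hS.support_subset x hx h)
    rw [Finset.insert_val_of_notMem hi, Multiset.map_cons]
    have hrat : (d i : ℚ) ∈ ratSpan (S.val.map d) := by
      rw [mem_ratSpan]
      refine Or.inr fun h0 => (hpos i₀).ne' ?_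
      exact (Multiset.gcd_eq_zero_iff _).1 h0 _ (Multiset.mem_map_of_mem d hS.mem)
    set B := index (d i) (S.val.map d) with hB
    -- By definition of the index, `B * d i` is a difference of weights over `S`. This is a relation
    -- with `i`-th coordinate `B`, which `hdvd` shows to be a multiple of `m i`.
    have hmB : m i ∣ B := by
      have h1 : ((B * d i : ℕ) : ℤ) ∈ intSpan (S.val.map d) := by
        rw [mem_intSpan, Int.natCast_dvd_natCast, (index_spec hrat).2]
      obtain ⟨u, v, hu, hv, huv⟩ := exists_weight_sub_of_mem_intSpan d S h1
      have hvi : v i = 0 := Finsupp.notMem_support_iff.1 fun h => hi (hv h)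
      have hui : u i = 0 := Finsupp.notMem_support_iff.1 fun h => hi (hu h)
      have h2 := hdvd (Finsupp.single i B + v) u
        (Finsupp.support_add.trans (Finset.union_subset
          (Finsupp.support_single_subset.trans (by simp))
          (hv.trans (Finset.subset_insert _ _))))
        (hu.trans (Finset.subset_insert _ _)) (by
          rw [map_add, Finsupp.weight_single, smul_eq_mul]
          omega)
      rw [Finsupp.add_apply, Finsupp.single_eq_same, hvi, hui] at h2
      simpa [Int.natCast_dvd_natCast] using h2
    obtain ⟨q, hq⟩ := hmB
    have hmem : B * d i ∈ natSpan (S.val.map d) := by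
      rw [mem_natSpan_map_iff]
      refine ⟨q • M i, Finsupp.support_smul.trans hMi, ?_⟩
      rw [map_nsmul, hMw, smul_eq_mul, hq]
      ring
    exact (scale_reflTransGen hrat).trans (.head (.removeMem _ _ hmem) (ih hspanS))

theorem isTriangular_univ {n : ℕ} {i₀ : Fin (n + 1)} {M : Fin (n + 1) → (Fin (n + 1) →₀ ℕ)}
    (h : ∀ J : Finset (Fin (n + 1)), J.Nonempty → i₀ ∉ J → ∃ i ∈ J, ∀ j ∈ J, M i j = 0) :
    IsTriangular i₀ M Finset.univ := by
  classical
  have key : ∀ j ≤ n, ∃ S, IsTriangular i₀ M S ∧ S.card = j + 1 := by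
    intro j
    induction j with
    | zero => exact fun _ => ⟨{i₀}, .singleton, by simp⟩
    | succ j ih =>
      intro hj
      obtain ⟨S, hS, hcard⟩ := ih (by omega)
      -- Among the variables not yet listed, one has `x ^ Mᵢ` free of all of them; it comes next.
      obtain ⟨i, hi, hMi⟩ := h Sᶜ (by
        rw [← Finset.card_pos, Finset.card_compl, Fintype.card_fin]
        omega) (by simpa using hS.mem)
      rw [Finset.mem_compl] at hi
      refine ⟨insert i S, .insert S i hi (fun l hl => ?_) hS, ?_⟩
      · by_contra hlS
        exact Finsupp.mem_support_iff.1 hl (hMi l (by simpa using hlS))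
      · rw [Finset.card_insert_of_notMem hi, hcard]
  obtain ⟨S, hS, hcard⟩ := key n le_rfl
  rwa [Finset.eq_univ_of_card S (by simpa using hcard)] at hS

theorem mainTheorem9 (k : Type*) [Field k] (n : ℕ) (hn : 2 ≤ n) (d : Fin n → ℕ)
    (hpos : ∀ i, 0 < d i) (hinj : Function.Injective d)
    (hdist : ∃ i₀ : Fin n, Set.InjOn (fun i => critMult d i * d i) {i | i ≠ i₀}) :
    IsCompleteIntersection (toricIdeal k d) ↔
      reducedSet (Finset.univ.val.map d) = ∅ := by
  obtain ⟨n, rfl⟩ : ∃ n', n = n' + 1 := ⟨n - 1, by omega⟩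
  rw [reducedSet_eq_iff]
  constructor
  · intro hCI
    obtain ⟨i₀, hdist⟩ := hdist
    have hm : ∀ i, 0 < critMult d i := fun i => (critMult_spec hn hpos i).1
    choose M hM hMw using fun i => (critMult_spec hn hpos i).2
    have hspan := toricIdeal_eq_span_critical k hn hpos hdist hM hMw hCI
    have htri : IsTriangular i₀ M Finset.univ := isTriangular_univ fun J hJ hi₀ =>
      exists_forall_eq_zero_of_span_eq k hpos hm hspan hJ hi₀
    refine ⟨htri.reflTransGen hpos hm hM hMw (spansRelations_univ k hspan), ?_⟩
    simp [CIReduction.IsReduced]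
  · rintro ⟨hred, -⟩
    exact isCompleteIntersection_of_hasFewRelations k d hpos
      (hasFewRelations_of_reflTransGen hred _ d (fun i _ => hpos i) rfl)
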